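/- Let $d\ge 1$ be an integer and $\mathbb T=\mathbb R/\mathbb Z$. There is a constant $C_1>0$ depending only on $d$, and for every $\varepsilon>0$ there is a constant $C_2>0$ depending only on $d$ and $\varepsilon$, such that the following holds. Let $N\ge 1$ be an integer, let $S_{d,N}=\{\mathbf n=(n_1,\dots,n_d)\in\mathbb Z^d: |n_j|\le N \text{ for } 1\le j\le d\}$, let $(a_{\mathbf n})_{\mathbf n\in S_{d,N}}$ be complex numbers with $\sum_{\mathbf n\in S_{d,N}}|a_{\mathbf n}|^2=1$, and define $F$ on $\mathbb T^{d}\times\mathbb T$ by $$F(\mathbf x,t)=\sum_{\mathbf n\in S_{d,N}}a_{\mathbf n}\,e^{2\pi i\,\mathbf n\cdot\mathbf x}\,e^{2\pi i|\mathbf n|^2t},\qquad |\mathbf n|^2=n_1^2+\cdots+n_d^2 .$$ For $\lambda>0$ let $E_\lambda=\{(\mathbf x,t)\in\mathbb T^{d+1}:|F(\mathbf x,t)|>\lambda\}$, and let $|E_\lambda|$ be its Lebesgue measure (normalized so that $|\mathbb T^{d+1}|=1$). Then for every real number $Q\ge N$ and every $\lambda>0$, $$\lambda^2|E_\lambda|^2\le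 C_1Q^{d/2}|E_\lambda|^2+\frac{C_2N^{\varepsilon}}{Q}|E_\lambda| .$$ -/

import Mathlib

/-- The box `S_{d,N} = {n ∈ ℤ^d : |n_j| ≤ N for all j}`. -/
noncomputable def latticeBox (d N : ℕ) : Finset (Fin d → ℤ) :=
  Fintype.piFinset fun _ => Finset.Icc (-(N : ℤ)) (N : ℤ)

/-- The torus `𝕋^d × 𝕋` with `𝕋 = ℝ/ℤ`; its `volume` is the product Lebesgue measure,
of total mass one. -/
abbrev SpaceTimeTorus (d : ℕ) : Type :=
  (Fin d → UnitAddCircle) × UnitAddCircle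

/-- The exponential sum
`F(x,t) = ∑_{n ∈ S_{d,N}} a_n e^{2πi n·x} e^{2πi |n|² t}`, a function on the torus;
`fourier k` is the character `s ↦ e^{2πi k s}` of `ℝ/ℤ`. -/
noncomputable def schrodingerSum (d N : ℕ) (a : (Fin d → ℤ) → ℂ)
    (z : SpaceTimeTorus d) : ℂ :=
  ∑ n ∈ latticeBox d N,
    a n * (∏ j, (fourier (n j) (z.1 j) : ℂ)) * (fourier (∑ j, n j ^ 2) z.2 : ℂ)

/-- The level set `E_λ = {(x,t) : |F(x,t)| > λ}`. -/
def levelSet (d N : ℕ) (a : (Fin d → ℤ) → ℂ) (lam : ℝ) : Set (SpaceTimeTorus d) :=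
  {z | lam < ‖schrodingerSum d N a z‖}

/-! The proof is a TT* argument with a kernel restricted to minor arcs. Put `M = ⌈Q⌉` and call `t`
minor if no `k t` with `1 ≤ k ≤ M` lies within `1/(4M)` of an integer. The kernel `K`
(`minorKernel`) is the indicator of minor `t` times a product over coordinates of Weyl sums with
tent weights. Two facts about `K` suffice.

Size: on minor arcs Weyl differencing gives `|K| ≤ C M^{d/2}` with no logarithm or `M^ε`, because
the tent weights make the correlation sums decay quadratically (`norm_tentWeylSum_sq_le`). This is
why `C₁` does not depend on `ε`.

Fourier coefficients: the coefficient of `K` at `(k₀, k)` is the tent weight of `k` times the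
coefficient of the minor indicator at `k₀ - |k|²` (`torusCoeff_minorKernel`). On the paraboloid it
is nonnegative, and at least `1/2` over the box, since minor arcs fill half the circle. Off the
paraboloid it is `O(M^{ε-1})`: Möbius inversion writes the indicator as a combination of dilated
arcs, and the divisor bound counts those that contribute
(`exists_norm_integral_fourier_mul_minorIndicator_le`).

Pairing `K` with the autocorrelation of `f` bounds the sum of `|f̂|²` over the paraboloid points of
the box by `M^{d/2} ‖f‖₁² + M^{ε-1} ‖f‖₂²`, up to constants. Taking `f` to be the phase of `F` on
the level set, both `‖f‖₁` and `‖f‖₂²` equal `|E_λ|`, and duality with Cauchy–Schwarz gives the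
claim. For `Q ≥ 9N²` the pointwise bound on `F` is enough. -/

open MeasureTheory

/-! ### Parseval and autocorrelations on the torus -/

theorem UnitAddCircle.volume_eq_haarAddCircle :
    (volume : Measure UnitAddCircle) = AddCircle.haarAddCircle := by
  simpa using AddCircle.volume_eq_smul_haarAddCircle (T := 1)

/-- The Fourier coefficient with respect to the standard volume on the torus. -/
noncomputable def torusCoeff {ι : Type*} [Fintype ι] (f : UnitAddTorus ι → ℂ) (n : ι → ℤ) : ℂ :=
  ∫ z, UnitAddTorus.mFourier (-n) z * f z

theorem torusCoeff_eq {ι : Type*} [Fintype ι] (f : UnitAddTorus ι → ℂ) (n : ι → ℤ) :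
    torusCoeff f n = UnitAddTorus.mFourierCoeff f n := by
  unfold torusCoeff UnitAddTorus.mFourierCoeff
  simp only [volume_pi, UnitAddCircle.volume_eq_haarAddCircle, smul_eq_mul]
  rfl

theorem hasSum_conj_torusCoeff_mul {ι : Type*} [Fintype ι] {f g : UnitAddTorus ι → ℂ}
    (hf : MemLp f 2) (hg : MemLp g 2) :
    HasSum (fun n => (starRingEnd ℂ) (torusCoeff f n) * torusCoeff g n)
      (∫ z, (starRingEnd ℂ) (f z) * g z) := by
  simp only [torusCoeff_eq]
  simp only [volume_pi, UnitAddCircle.volume_eq_haarAddCircle] at hf hg ⊢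
  have h := UnitAddTorus.hasSum_prod_mFourierCoeff (hf.toLp f) (hg.toLp g)
  have e : ∀ (u : UnitAddTorus ι → ℂ) (hu : MemLp u 2 (Measure.pi fun _ : ι => AddCircle.haarAddCircle)) n,
      UnitAddTorus.mFourierCoeff (hu.toLp u) n = UnitAddTorus.mFourierCoeff u n := by
    intro u hu n
    refine integral_congr_ae ?_
    filter_upwards [hu.coeFn_toLp] with z hz
    rw [hz]
  simp only [e] at h
  convert h using 1
  refine integral_congr_ae ?_
  filter_upwards [hf.coeFn_toLp, hg.coeFn_toLp] with z hz hz'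
  rw [hz, hz']

theorem measureReal_univ_unitAddTorus {ι : Type*} [Fintype ι] :
    volume.real (Set.univ : Set (UnitAddTorus ι)) = 1 := by
  simp [measureReal_def, volume_pi, Measure.pi_univ]

theorem norm_mFourier_apply {ι : Type*} [Fintype ι] (n : ι → ℤ) (z : UnitAddTorus ι) :
    ‖UnitAddTorus.mFourier n z‖ = 1 := by
  simp only [UnitAddTorus.mFourier, ContinuousMap.coe_mk, norm_prod]
  exact Finset.prod_eq_one fun i _ => Circle.norm_coe _

theorem mFourier_apply_add {ι : Type*} [Fintype ι] (n : ι → ℤ) (z w : UnitAddTorus ι) :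
    UnitAddTorus.mFourier n (z + w) = UnitAddTorus.mFourier n z * UnitAddTorus.mFourier n w := by
  simp [UnitAddTorus.mFourier, ← Finset.prod_mul_distrib, fourier_apply, AddCircle.toCircle_add]

theorem torusCoeff_comp_sub {ι : Type*} [Fintype ι] (f : UnitAddTorus ι → ℂ) (n : ι → ℤ)
    (s : UnitAddTorus ι) :
    torusCoeff (fun z => f (z - s)) n = UnitAddTorus.mFourier (-n) s * torusCoeff f n := by
  unfold torusCoeff
  rw [← integral_sub_right_eq_self (fun z => UnitAddTorus.mFourier (-n) s *
    (UnitAddTorus.mFourier (-n) z * f z)) s |>.trans (integral_const_mul _ _)]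
  congr 1 with z
  rw [← mul_assoc, ← mFourier_apply_add, add_sub_cancel]

theorem memLp_of_measurable_of_bound {α : Type*} [MeasurableSpace α] {μ : Measure α}
    [IsFiniteMeasure μ] {f : α → ℂ} (hf : Measurable f) {B : ℝ} (hB : ∀ z, ‖f z‖ ≤ B) (p) :
    MemLp f p μ :=
  MemLp.of_bound hf.aestronglyMeasurable B (.of_forall hB)

theorem integrable_of_measurable_of_bound {α : Type*} [MeasurableSpace α] {μ : Measure α}
    [IsFiniteMeasure μ] {f : α → ℂ} (hf : Measurable f) {B : ℝ} (hB : ∀ z, ‖f z‖ ≤ B) :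
    Integrable f μ :=
  Integrable.of_bound hf.aestronglyMeasurable B (.of_forall hB)

theorem hasSum_norm_sq_torusCoeff {ι : Type*} [Fintype ι] {f : UnitAddTorus ι → ℂ}
    (hf : MemLp f 2) :
    HasSum (fun n => ‖torusCoeff f n‖ ^ 2) (∫ z, ‖f z‖ ^ 2) := by
  have h := hasSum_conj_torusCoeff_mul hf hf
  simp only [Complex.conj_mul'] at h
  have e : (∫ z, (‖f z‖ : ℂ) ^ 2) = ((∫ z, ‖f z‖ ^ 2 : ℝ) : ℂ) := by
    rw [← integral_complex_ofReal]; simp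
  rw [e] at h
  exact_mod_cast h

/-- For fixed `s`, Parseval expands the autocorrelation of `f` as a Fourier series in `s` with
coefficients `|f̂|²`. These are summable, so the series may be integrated against the bounded `K`
term by term. -/
theorem hasSum_norm_sq_torusCoeff_mul {ι : Type*} [Fintype ι] {f K : UnitAddTorus ι → ℂ}
    (hf : Measurable f) {B : ℝ} (hB : ∀ z, ‖f z‖ ≤ B) (hK : Measurable K) {B' : ℝ}
    (hB' : ∀ z, ‖K z‖ ≤ B') :
    HasSum (fun n => (‖torusCoeff f n‖ ^ 2 : ℂ) * torusCoeff K n)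
      (∫ s, K s * ∫ z, (starRingEnd ℂ) (f z) * f (z - s)) := by
  have hB0 : 0 ≤ B' := (norm_nonneg _).trans (hB' 0)
  have hA : ∀ s, HasSum (fun n => K s * ((‖torusCoeff f n‖ ^ 2 : ℂ) * UnitAddTorus.mFourier (-n) s))
      (K s * ∫ z, (starRingEnd ℂ) (f z) * f (z - s)) := by
    intro s
    refine HasSum.mul_left _ ?_
    refine (hasSum_conj_torusCoeff_mul (memLp_of_measurable_of_bound (μ := volume) hf hB 2)
      (memLp_of_measurable_of_bound (μ := volume) (f := fun z => f (z - s)) (by fun_prop)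
        (fun z => hB _) 2)).congr_fun fun n => ?_
    rw [torusCoeff_comp_sub, ← Complex.conj_mul']
    ring
  have hm : ∀ n : ι → ℤ, Integrable fun s => K s * ((‖torusCoeff f n‖ ^ 2 : ℂ) *
      UnitAddTorus.mFourier (-n) s) := by
    intro n
    refine integrable_of_measurable_of_bound (B := B' * ‖torusCoeff f n‖ ^ 2) ?_ ?_
    · have := (UnitAddTorus.mFourier (-n)).continuous.measurable
      fun_prop
    · intro s
      simp only [norm_mul, norm_pow, norm_mFourier_apply, Complex.norm_real, mul_one, norm_norm]
      gcongr
      exact hB' s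
  have := hasSum_integral_of_summable_integral_norm hm ?_
  · simp only [(hA _).tsum_eq] at this
    refine this.congr_fun fun n => ?_
    rw [show torusCoeff K n = ∫ z, UnitAddTorus.mFourier (-n) z * K z from rfl, ← integral_const_mul]
    congr 1 with s
    ring
  · refine Summable.of_nonneg_of_le (fun n => integral_nonneg fun _ => norm_nonneg _) (fun n => ?_)
      ((hasSum_norm_sq_torusCoeff (memLp_of_measurable_of_bound hf hB 2)).summable.mul_left B')
    refine (integral_mono (hm n).norm (integrable_const (B' * ‖torusCoeff f n‖ ^ 2)) ?_).trans
      (by simp [measureReal_univ_unitAddTorus])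
    intro s
    simp only [norm_mul, norm_pow, norm_mFourier_apply, Complex.norm_real, mul_one, norm_norm]
    gcongr
    exact hB' s

/-- By Fubini, the autocorrelation has `L¹` norm at most `‖f‖₁²`. -/
theorem norm_integral_mul_autocorrelation_le {ι : Type*} [Fintype ι] {f K : UnitAddTorus ι → ℂ}
    (hf : Measurable f) {B : ℝ} (hB : ∀ z, ‖f z‖ ≤ B) {B' : ℝ} (hB' : ∀ z, ‖K z‖ ≤ B') :
    ‖∫ s, K s * ∫ z, (starRingEnd ℂ) (f z) * f (z - s)‖ ≤ B' * (∫ z, ‖f z‖) ^ 2 := by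
  have hB0 : 0 ≤ B' := (norm_nonneg _).trans (hB' 0)
  have hB1 : 0 ≤ B := (norm_nonneg _).trans (hB 0)
  have hint : Integrable (Function.uncurry fun s z : UnitAddTorus ι => ‖f (z + s)‖ * ‖f z‖)
      (volume.prod volume) := by
    refine Integrable.of_bound (C := B * B) (by unfold Function.uncurry; fun_prop) (.of_forall ?_)
    intro p
    simp only [Function.uncurry, norm_mul, norm_norm]
    gcongr <;> exact hB _
  calc _ ≤ ∫ s, B' * ∫ z, ‖f (z + s)‖ * ‖f z‖ := by
        refine norm_integral_le_of_norm_le (hint.integral_prod_left.const_mul B') (.of_forall ?_)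
        intro s
        rw [norm_mul]
        gcongr
        · exact hB' s
        · refine (norm_integral_le_integral_norm _).trans_eq ?_
          rw [← integral_sub_right_eq_self (fun z => ‖f (z + s)‖ * ‖f z‖) s]
          simp
    _ = B' * ∫ z, ∫ s, ‖f (z + s)‖ * ‖f z‖ := by
        rw [integral_const_mul, integral_integral_swap hint]
    _ = _ := by
        congr 1
        simp only [integral_mul_const, integral_add_left_eq_self (fun s => ‖f s‖),
          integral_const_mul, sq]

/-! ### Linear exponential sums with tent weights -/

theorem four_mul_abs_le_norm_fourier_one_sub_one {y : ℝ} (hy : |y| ≤ 1 / 2) :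
    4 * |y| ≤ ‖(fourier 1 (y : UnitAddCircle) : ℂ) - 1‖ := by
  have h1 : (fourier 1 (y : UnitAddCircle) : ℂ) = Complex.exp (Complex.I * (2 * Real.pi * y : ℝ)) := by
    rw [fourier_coe_apply]; congr 1; push_cast; ring
  rw [h1, Complex.norm_exp_I_mul_ofReal_sub_one, norm_mul, Real.norm_eq_abs, Real.norm_eq_abs, abs_two]
  have := Real.mul_abs_le_abs_sin (x := 2 * Real.pi * y / 2) (by
    rw [show 2 * Real.pi * y / 2 = Real.pi * y by ring, abs_mul, abs_of_pos Real.pi_pos]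
    nlinarith [Real.pi_pos])
  rw [show 2 * Real.pi * y / 2 = Real.pi * y by ring, abs_mul, abs_of_pos Real.pi_pos] at this
  rw [show 2 * Real.pi * y / 2 = Real.pi * y by ring]
  have h2 : 2 / Real.pi * (Real.pi * |y|) = 2 * |y| := by
    field_simp
  linarith

theorem norm_fourier_apply (n : ℤ) (x : UnitAddCircle) : ‖(fourier n x : ℂ)‖ = 1 :=
  Circle.norm_coe _

/-- Double summation by parts. -/
theorem norm_sq_mul_norm_sum_fourier_le (B : ℤ) (u : ℤ → ℝ) (hu : ∀ n, B < |n| → u n = 0)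
    (x : UnitAddCircle) :
    ‖(fourier 1 x : ℂ) - 1‖ ^ 2 * ‖∑ n ∈ Finset.Icc (-B) B, (u n : ℂ) * fourier n x‖ ≤
      ∑ n ∈ Finset.Icc (-B - 1) (B + 1), |u (n + 1) - 2 * u n + u (n - 1)| := by
  have key : ∀ (v : ℤ → ℝ) (I : Finset ℤ), (∀ n ∉ I, v n = 0) →
      HasSum (fun n => (v n : ℂ) * fourier n x) (∑ n ∈ I, (v n : ℂ) * fourier n x) := fun v I h =>
    hasSum_sum_of_ne_finset_zero fun n hn => by simp [h n hn]
  have hz : ∀ n ∉ Finset.Icc (-B) B, u n = 0 := fun n hn => hu n <| by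
    simp only [Finset.mem_Icc, ← abs_le] at hn; omega
  have h0 := key u (Finset.Icc (-B) B) hz
  set S := ∑ n ∈ Finset.Icc (-B) B, (u n : ℂ) * fourier n x with hS
  have hp : HasSum (fun n : ℤ => (u (n + 1) : ℂ) * fourier n x) (fourier (-1) x * S) := by
    have := ((Equiv.addRight (1 : ℤ)).hasSum_iff.mpr h0).mul_left (fourier (-1) x : ℂ)
    refine this.congr_fun fun n => ?_
    simp only [Function.comp, Equiv.coe_addRight]
    rw [mul_left_comm, ← fourier_add]; congr 3; ring
  have hm : HasSum (fun n : ℤ => (u (n - 1) : ℂ) * fourier n x) (fourier 1 x * S) := by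
    have := ((Equiv.subRight (1 : ℤ)).hasSum_iff.mpr h0).mul_left (fourier 1 x : ℂ)
    refine this.congr_fun fun n => ?_
    simp only [Function.comp, Equiv.subRight_apply]
    rw [mul_left_comm, ← fourier_add]; congr 3; ring
  have h1 := (hp.sub (h0.mul_left 2)).add hm
  -- The second difference of `u` may be nonzero one step outside the support of `u`, hence the
  -- wider range.
  have h2 := key (fun n => u (n + 1) - 2 * u n + u (n - 1)) (Finset.Icc (-B - 1) (B + 1)) (by
    intro n hn
    have hn' : B + 1 < |n| := by
      rw [Finset.mem_Icc] at hn
      by_contra hc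
      rw [not_lt, abs_le] at hc
      omega
    have e1 := abs_sub_abs_le_abs_sub n (n + 1)
    have e2 := abs_sub_abs_le_abs_sub n (n - 1)
    simp only [sub_add_cancel_left, sub_sub_cancel, abs_neg, abs_one] at e1 e2
    simp [hu n (by omega), hu (n + 1) (by omega), hu (n - 1) (by omega)])
  have h3 := h1.unique (h2.congr_fun fun n => by push_cast; ring)
  -- With `w = e(x)`, `w⁻¹ - 2 + w = w⁻¹ (w - 1)²`.
  have h4 : ‖(fourier 1 x : ℂ) - 1‖ ^ 2 * ‖S‖ =
      ‖(fourier (-1) x : ℂ) * S - 2 * S + fourier 1 x * S‖ := by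
    have h5 : (fourier (-1) x : ℂ) * fourier 1 x = 1 := by
      rw [← fourier_add]; simp
    have : (fourier (-1) x : ℂ) * S - 2 * S + fourier 1 x * S =
        fourier (-1) x * ((fourier 1 x - 1) ^ 2 * S) := by
      linear_combination (2 * S - fourier 1 x * S) * h5
    rw [this, norm_mul, norm_fourier_apply, one_mul, norm_mul, norm_pow]
  rw [h4, h3]
  refine (norm_sum_le _ _).trans (Finset.sum_le_sum fun n _ => ?_)
  rw [norm_mul, norm_fourier_apply, mul_one, Complex.norm_real, Real.norm_eq_abs]

/-- The tent of height `2` and half-width `2M`. -/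
noncomputable def tent (M : ℕ) (n : ℤ) : ℝ :=
  (|(n : ℝ) + 2 * M| + |(n : ℝ) - 2 * M| - 2 * |(n : ℝ)|) / (2 * M)

theorem tent_nonneg (M : ℕ) (n : ℤ) : 0 ≤ tent M n := by
  refine div_nonneg ?_ (by positivity)
  have := abs_add_le ((n : ℝ) + 2 * M) (n - 2 * M)
  rw [show (n : ℝ) + 2 * M + (n - 2 * M) = 2 * n by ring, abs_mul, abs_two] at this
  linarith

theorem tent_le_two {M : ℕ} (hM : 1 ≤ M) (n : ℤ) : tent M n ≤ 2 := by
  have hM' : (1 : ℝ) ≤ M := by exact_mod_cast hM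
  rw [tent, div_le_iff₀ (by positivity)]
  rcases abs_cases ((n : ℝ) + 2 * M) with h1 | h1 <;> rcases abs_cases ((n : ℝ) - 2 * M) with h2 | h2 <;>
    rcases abs_cases (n : ℝ) with h3 | h3 <;> linarith

theorem one_le_tent {M : ℕ} (hM : 1 ≤ M) {n : ℤ} (hn : |n| ≤ M) : 1 ≤ tent M n := by
  have hM' : (1 : ℝ) ≤ M := by exact_mod_cast hM
  have hn' : |(n : ℝ)| ≤ M := by exact_mod_cast hn
  rw [tent, le_div_iff₀ (by positivity)]
  rcases abs_cases ((n : ℝ) + 2 * M) with h1 | h1 <;> rcases abs_cases ((n : ℝ) - 2 * M) with h2 | h2 <;>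
    rcases abs_cases (n : ℝ) with h3 | h3 <;> linarith

theorem tent_eq_zero {M : ℕ} {n : ℤ} (hn : 2 * (M : ℤ) ≤ |n|) : tent M n = 0 := by
  have hn' : 2 * (M : ℝ) ≤ |(n : ℝ)| := by exact_mod_cast hn
  have hM' : (0 : ℝ) ≤ M := by positivity
  rw [tent, div_eq_zero_iff]
  left
  rcases abs_cases ((n : ℝ) + 2 * M) with h1 | h1 <;> rcases abs_cases ((n : ℝ) - 2 * M) with h2 | h2 <;>
    rcases abs_cases (n : ℝ) with h3 | h3 <;> linarith

/-- The tent is a combination of three absolute values, and the second difference of an absolute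
value is twice a point mass. The second differences of the tent therefore have total mass `O(1/M)`.
-/
theorem abs_int_second_diff (a b : ℤ) :
    |((a + 1 : ℤ) : ℝ) + b| - 2 * |(a : ℝ) + b| + |((a - 1 : ℤ) : ℝ) + b| = if a = -b then 2 else 0 := by
  rw [← Int.cast_add, ← Int.cast_add, ← Int.cast_add]
  have : |a + 1 + b| - 2 * |a + b| + |a - 1 + b| = if a = -b then 2 else 0 := by
    split_ifs with h
    · subst h; norm_num [show -b - 1 + b = -1 by ring]
    · rcases abs_cases (a + 1 + b) with h1 | h1 <;> rcases abs_cases (a + b) with h2 | h2 <;>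
        rcases abs_cases (a - 1 + b) with h3 | h3 <;> omega
  have h2 := congrArg (Int.cast : ℤ → ℝ) this
  push_cast at h2 ⊢
  exact h2

theorem tent_second_diff (M : ℕ) (n : ℤ) :
    tent M (n + 1) - 2 * tent M n + tent M (n - 1) =
      ((if n = -(2 * M : ℤ) then 2 else 0) + (if n = (2 * M : ℤ) then 2 else 0) -
        2 * (if n = 0 then 2 else 0)) / (2 * M) := by
  have h1 := abs_int_second_diff n (2 * M)
  have h2 := abs_int_second_diff n (-(2 * M))
  have h3 := abs_int_second_diff n 0
  rw [neg_neg] at h2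
  rw [neg_zero] at h3
  rw [← h1, ← h2, ← h3]
  unfold tent
  push_cast
  simp only [add_zero, ← sub_eq_add_neg]
  ring

theorem sum_abs_tent_second_diff_le {M : ℕ} (hM : 1 ≤ M) (I : Finset ℤ) :
    ∑ n ∈ I, |tent M (n + 1) - 2 * tent M n + tent M (n - 1)| ≤ 4 / M := by
  have hM' : (1 : ℝ) ≤ M := by exact_mod_cast hM
  have h : ∀ c : ℤ, ∑ n ∈ I, (if n = c then (2 : ℝ) else 0) ≤ 2 := by
    intro c
    rw [Finset.sum_ite_eq']
    split_ifs <;> norm_num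
  calc _ ≤ ∑ n ∈ I, ((if n = -(2 * M : ℤ) then (2 : ℝ) else 0) + (if n = (2 * M : ℤ) then 2 else 0) +
        2 * (if n = 0 then 2 else 0)) / (2 * M) := by
        refine Finset.sum_le_sum fun n _ => ?_
        rw [tent_second_diff, abs_div, abs_of_nonneg (by positivity : (0 : ℝ) ≤ 2 * M)]
        gcongr
        rw [abs_le]
        constructor <;> split_ifs <;> norm_num
    _ ≤ _ := by
        rw [← Finset.sum_div, Finset.sum_add_distrib, Finset.sum_add_distrib, ← Finset.mul_sum,
          div_le_div_iff₀ (by positivity) (by positivity)]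
        nlinarith [h (-(2 * M : ℤ)), h (2 * M : ℤ), h 0]

theorem abs_tent_succ_sub_le {M : ℕ} (hM : 1 ≤ M) (n : ℤ) : |tent M (n + 1) - tent M n| ≤ 1 / M := by
  have hM' : (1 : ℝ) ≤ M := by exact_mod_cast hM
  have e : tent M (n + 1) - tent M n = ((|((n : ℝ) + 2 * M) + 1| - |(n : ℝ) + 2 * M|) +
      (|((n : ℝ) - 2 * M) + 1| - |(n : ℝ) - 2 * M|) - 2 * (|(n : ℝ) + 1| - |(n : ℝ)|)) / (2 * M) := by
    unfold tent
    push_cast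
    rw [show (n : ℝ) + 1 + 2 * M = n + 2 * M + 1 by ring, show (n : ℝ) + 1 - 2 * M = n - 2 * M + 1 by ring]
    ring
  rw [e, abs_div, abs_of_nonneg (by positivity : (0 : ℝ) ≤ 2 * M), div_le_div_iff₀ (by positivity) (by positivity)]
  suffices h : |(|((n : ℝ) + 2 * M) + 1| - |(n : ℝ) + 2 * M|) +
      (|((n : ℝ) - 2 * M) + 1| - |(n : ℝ) - 2 * M|) - 2 * (|(n : ℝ) + 1| - |(n : ℝ)|)| ≤ 2 by nlinarith
  have hi : |(|n + 2 * M + 1| - |n + 2 * M|) +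
      (|n - 2 * M + 1| - |n - 2 * M|) - 2 * (|n + 1| - |n|)| ≤ (2 : ℤ) := by
    rw [abs_le]
    rcases abs_cases (n + 2 * M + 1) with h1 | h1 <;> rcases abs_cases (n + 2 * M) with h2 | h2 <;>
      rcases abs_cases (n - 2 * M + 1) with h3 | h3 <;> rcases abs_cases (n - 2 * M) with h4 | h4 <;>
      rcases abs_cases (n + 1) with h5 | h5 <;> rcases abs_cases n with h6 | h6 <;> omega
  exact_mod_cast hi

/-- Discrete Leibniz rule: the cross terms are products of first differences. -/
theorem abs_second_diff_mul_le (a₀ a₁ a₂ b₀ b₁ b₂ δ : ℝ) (ha : |a₁| ≤ 2) (hb : |b₁| ≤ 2)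
    (h₂ : |b₂ - b₁| ≤ δ) (h₀ : |b₁ - b₀| ≤ δ) :
    |a₂ * b₂ - 2 * (a₁ * b₁) + a₀ * b₀| ≤ 2 * |a₂ - 2 * a₁ + a₀| + 2 * |b₂ - 2 * b₁ + b₀| +
      δ * (|a₂ - a₁| + |a₁ - a₀|) := by
  have e : a₂ * b₂ - 2 * (a₁ * b₁) + a₀ * b₀ = (a₂ - 2 * a₁ + a₀) * b₁ + a₁ * (b₂ - 2 * b₁ + b₀) +
      ((a₂ - a₁) * (b₂ - b₁) + (a₁ - a₀) * (b₁ - b₀)) := by ring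
  rw [e]
  refine (abs_add_three _ _ _).trans ?_
  have h3 := abs_add_le ((a₂ - a₁) * (b₂ - b₁)) ((a₁ - a₀) * (b₁ - b₀))
  simp only [abs_mul] at h3 ⊢
  nlinarith [abs_nonneg (a₂ - 2 * a₁ + a₀), abs_nonneg (b₂ - 2 * b₁ + b₀), abs_nonneg (a₂ - a₁),
    abs_nonneg (a₁ - a₀), mul_le_mul_of_nonneg_left hb (abs_nonneg (a₂ - 2 * a₁ + a₀)),
    mul_le_mul_of_nonneg_right ha (abs_nonneg (b₂ - 2 * b₁ + b₀)),
    mul_le_mul_of_nonneg_left h₂ (abs_nonneg (a₂ - a₁)),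
    mul_le_mul_of_nonneg_left h₀ (abs_nonneg (a₁ - a₀))]

theorem abs_tent_le {M : ℕ} (hM : 1 ≤ M) (n : ℤ) : |tent M n| ≤ 2 := by
  rw [abs_of_nonneg (tent_nonneg M n)]; exact tent_le_two hM n

/-- The second differences of either factor contribute `8/M`, whatever the shift `h`. The cross
terms are at most `2/M²` at each of `4M + 3` points, so at most `14/M` in all. -/
theorem sum_abs_tent_mul_second_diff_le {M : ℕ} (hM : 1 ≤ M) (h : ℤ) :
    ∑ n ∈ Finset.Icc (-(2 * M : ℤ) - 1) (2 * M + 1),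
      |tent M (n + 1) * tent M (n + 1 + h) - 2 * (tent M n * tent M (n + h)) +
        tent M (n - 1) * tent M (n - 1 + h)| ≤ 30 / M := by
  have hM' : (1 : ℝ) ≤ M := by exact_mod_cast hM
  have hd : ∀ n : ℤ, |tent M n - tent M (n - 1)| ≤ 1 / M := fun n => by
    have := abs_tent_succ_sub_le hM (n - 1)
    rwa [sub_add_cancel] at this
  calc _ ≤ ∑ n ∈ Finset.Icc (-(2 * M : ℤ) - 1) (2 * M + 1),
        (2 * |tent M (n + 1) - 2 * tent M n + tent M (n - 1)| +
        2 * |tent M (n + h + 1) - 2 * tent M (n + h) + tent M (n + h - 1)| + 1 / M * (2 / M)) := by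
        refine Finset.sum_le_sum fun n _ => ?_
        rw [add_right_comm n 1 h, sub_add_eq_add_sub n 1 h]
        refine (abs_second_diff_mul_le _ _ _ _ _ _ (1 / M) (abs_tent_le hM _) (abs_tent_le hM _)
          (abs_tent_succ_sub_le hM _) (hd _)).trans ?_
        have : |tent M (n + 1) - tent M n| + |tent M n - tent M (n - 1)| ≤ 2 / M := by
          have := add_le_add (abs_tent_succ_sub_le hM n) (hd n)
          exact this.trans_eq (by ring)
        gcongr
    _ ≤ 2 * (4 / M) + 2 * (4 / M) + (4 * M + 3) * (1 / M * (2 / M)) := by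
        rw [Finset.sum_add_distrib, Finset.sum_add_distrib, ← Finset.mul_sum, ← Finset.mul_sum,
          Finset.sum_const, Int.card_Icc, nsmul_eq_mul]
        have h2 : ∑ n ∈ Finset.Icc (-(2 * M : ℤ) - 1) (2 * M + 1),
            |tent M (n + h + 1) - 2 * tent M (n + h) + tent M (n + h - 1)| ≤ 4 / M := by
          have := sum_abs_tent_second_diff_le hM
            ((Finset.Icc (-(2 * M : ℤ) - 1) (2 * M + 1)).map (addRightEmbedding h))
          rwa [Finset.sum_map] at this
        have h3 : (((2 * M + 1 + 1 - (-(2 * M : ℤ) - 1)).toNat : ℕ) : ℝ) = 4 * M + 3 := by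
          rw [show (2 * M + 1 + 1 - (-(2 * M : ℤ) - 1)) = ((4 * M + 3 : ℕ) : ℤ) by push_cast; ring,
            Int.toNat_natCast]
          push_cast; ring
        rw [h3]
        gcongr
        exact sum_abs_tent_second_diff_le hM _
    _ ≤ 30 / M := by
        rw [show 2 * (4 / (M : ℝ)) + 2 * (4 / M) + (4 * M + 3) * (1 / M * (2 / M)) =
          (16 + (4 * M + 3) * 2 / M) / M by field_simp; ring]
        gcongr
        rw [← le_sub_iff_add_le', div_le_iff₀ (by positivity)]
        linarith

theorem tent_correlation_trivial {M : ℕ} (hM : 1 ≤ M) (h : ℤ) (x : UnitAddCircle) :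
    ‖∑ n ∈ Finset.Icc (-(2 * M : ℤ)) (2 * M), ((tent M n * tent M (n + h) : ℝ) : ℂ) * fourier n x‖ ≤
      20 * M := by
  have hM' : (1 : ℝ) ≤ M := by exact_mod_cast hM
  calc _ ≤ ∑ n ∈ Finset.Icc (-(2 * M : ℤ)) (2 * M), (4 : ℝ) := by
        refine (norm_sum_le _ _).trans (Finset.sum_le_sum fun n _ => ?_)
        rw [norm_mul, norm_fourier_apply, mul_one, Complex.norm_real, Real.norm_eq_abs, abs_mul]
        nlinarith [abs_tent_le hM n, abs_tent_le hM (n + h), abs_nonneg (tent M n),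
          abs_nonneg (tent M (n + h))]
    _ = (4 * M + 1) * 4 := by
        rw [Finset.sum_const, Int.card_Icc, nsmul_eq_mul,
          show (2 * M + 1 - (-(2 * M : ℤ))) = ((4 * M + 1 : ℕ) : ℤ) by push_cast; ring,
            Int.toNat_natCast]
        push_cast; ring
    _ ≤ _ := by linarith

theorem tent_correlation_decay {M : ℕ} (hM : 1 ≤ M) (h : ℤ) {y : ℝ} (hy : |y| ≤ 1 / 2) :
    (16 * y ^ 2) * ‖∑ n ∈ Finset.Icc (-(2 * M : ℤ)) (2 * M),
      ((tent M n * tent M (n + h) : ℝ) : ℂ) * fourier n (y : UnitAddCircle)‖ ≤ 30 / M := by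
  refine le_trans ?_ ((norm_sq_mul_norm_sum_fourier_le (2 * M) (fun n => tent M n * tent M (n + h))
    (fun n hn => by simp [tent_eq_zero hn.le]) y).trans (sum_abs_tent_mul_second_diff_le hM h))
  gcongr
  have := pow_le_pow_left₀ (by positivity) (four_mul_abs_le_norm_fourier_one_sub_one hy) 2
  rw [mul_pow, sq_abs] at this
  linarith

/-! ### The Weyl sum on minor arcs -/

/-- The index of the arc of length `1 / (4M)` containing `y` modulo one. -/
noncomputable def arcIndex (M : ℕ) (y : ℝ) : ℕ := ⌊4 * M * Int.fract y⌋₊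

/-- The majorant of the correlation sums of `tent` in terms of `arcIndex`. -/
noncomputable def arcMajorant (M j : ℕ) : ℝ :=
  128 * M * (1 / ((j : ℝ) + 1) ^ 2 + 1 / ((4 * M : ℝ) - j) ^ 2)

theorem arcIndex_lt {M : ℕ} (hM : 1 ≤ M) (y : ℝ) : arcIndex M y < 4 * M := by
  have hM' : (1 : ℝ) ≤ M := by exact_mod_cast hM
  rw [arcIndex, Nat.floor_lt (by have := Int.fract_nonneg y; positivity)]
  push_cast
  nlinarith [Int.fract_lt_one y]

theorem tent_correlation_le {M : ℕ} (hM : 1 ≤ M) (h : ℤ) (y : ℝ) :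
    ‖∑ n ∈ Finset.Icc (-(2 * M : ℤ)) (2 * M),
      ((tent M n * tent M (n + h) : ℝ) : ℂ) * fourier n (y : UnitAddCircle)‖ ≤
      arcMajorant M (arcIndex M y) := by
  have hM' : (1 : ℝ) ≤ M := by exact_mod_cast hM
  have hf0 := Int.fract_nonneg y
  have hf1 := Int.fract_lt_one y
  have hj := arcIndex_lt hM y
  have hj' : (arcIndex M y : ℝ) + 1 ≤ 4 * M := by exact_mod_cast hj
  have hj1 : (arcIndex M y : ℝ) ≤ 4 * M * Int.fract y := Nat.floor_le (by positivity)
  have hj2 : 4 * M * Int.fract y < arcIndex M y + 1 := Nat.lt_floor_add_one _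
  have hy1 : (y : UnitAddCircle) = ((Int.fract y : ℝ) : UnitAddCircle) := by
    conv_lhs => rw [← Int.floor_add_fract y]
    rw [AddCircle.coe_add]
    simp
  have hy2 : (y : UnitAddCircle) = ((Int.fract y - 1 : ℝ) : UnitAddCircle) := by
    rw [AddCircle.coe_sub, ← hy1, AddCircle.coe_period, sub_zero]
  set j := arcIndex M y
  have htriv := tent_correlation_trivial hM h (y : UnitAddCircle)
  set S := ‖∑ n ∈ Finset.Icc (-(2 * M : ℤ)) (2 * M),
      ((tent M n * tent M (n + h) : ℝ) : ℂ) * fourier n (y : UnitAddCircle)‖ with hS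
  have hSn : 0 ≤ S := norm_nonneg _
  -- Here `z` is a representative of `y` in `[-1/2, 1/2]` and `a - 1` counts the full cells between
  -- it and `0`, so `a ≥ 2` gives `a ≤ 2(a - 1) ≤ 8M|z|`. The constant `128` covers both `20M · 4`,
  -- the trivial bound when `a < 2`, and `4M · 30`, the decay bound when `a ≥ 2`.
  have main : ∀ z a : ℝ, |z| ≤ 1 / 2 → (y : UnitAddCircle) = (z : UnitAddCircle) → 1 ≤ a →
      (2 ≤ a → a ≤ 8 * M * |z|) → a < 2 ∨ 2 ≤ a → S ≤ 128 * M * (1 / a ^ 2) := by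
    intro z a hz hyz ha1 ha hc
    rw [mul_one_div, le_div_iff₀ (by positivity)]
    rcases hc with hc | hc
    · nlinarith [mul_le_mul_of_nonneg_left (show a ^ 2 ≤ 4 by nlinarith) hSn]
    · have h1 := tent_correlation_decay hM h hz
      rw [← hyz, ← hS, le_div_iff₀ (by positivity)] at h1
      have h2 : a ^ 2 ≤ 64 * M ^ 2 * z ^ 2 := by
        have := pow_le_pow_left₀ (by linarith) (ha hc) 2
        rw [mul_pow, sq_abs] at this
        linarith
      calc S * a ^ 2 ≤ S * (64 * M ^ 2 * z ^ 2) := by gcongr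
        _ = 4 * M * (16 * z ^ 2 * S * M) := by ring
        _ ≤ 4 * M * 30 := by gcongr
        _ ≤ _ := by linarith
  unfold arcMajorant
  have p1 : 0 ≤ 1 / ((j : ℝ) + 1) ^ 2 := by positivity
  have p2 : 0 ≤ 1 / ((4 * M : ℝ) - j) ^ 2 := by positivity
  rcases le_total (Int.fract y) (1 / 2) with hc | hc
  · refine (main (Int.fract y) (j + 1) (by rwa [abs_of_nonneg hf0]) hy1 (by linarith [(Nat.cast_nonneg j : (0 : ℝ) ≤ j)]) ?_
      (lt_or_ge _ _)).trans ?_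
    · intro h2
      rw [abs_of_nonneg hf0]
      linarith
    · gcongr
      linarith
  · refine (main (Int.fract y - 1) (4 * M - j) (by rw [abs_le]; constructor <;> linarith) hy2 (by linarith) ?_
      (lt_or_ge _ _)).trans ?_
    · intro h2
      rw [abs_of_nonpos (by linarith)]
      linarith
    · gcongr
      linarith

/-- The points of the circle none of whose first `M` multiples is within `1 / (4M)` of zero. -/
def minorArc (M : ℕ) : Set UnitAddCircle := {t | ∀ k : ℕ, 1 ≤ k → k ≤ M → 1 / (4 * M : ℝ) < ‖k • t‖}

theorem sum_range_inv_sq_le_two (K : ℕ) : ∑ j ∈ Finset.range K, 1 / ((j : ℝ) + 1) ^ 2 ≤ 2 := by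
  have : ∑ j ∈ Finset.range K, 1 / ((j : ℝ) + 1) ^ 2 ≤ 2 - 1 / (K : ℝ) := by
    induction K with
    | zero => simp
    | succ K ih =>
      rw [Finset.sum_range_succ]
      rcases Nat.eq_zero_or_pos K with rfl | hK
      · norm_num
      · have hK' : (0 : ℝ) < K := by exact_mod_cast hK
        have : 1 / ((K : ℝ) + 1) ^ 2 ≤ 1 / K - 1 / (K + 1) := by
          rw [div_sub_div _ _ (by positivity) (by positivity), div_le_div_iff₀ (by positivity) (by positivity)]
          nlinarith
        push_cast
        linarith
  have h : (0 : ℝ) ≤ 1 / K := by positivity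
  linarith

theorem arcMajorant_nonneg (M j : ℕ) : 0 ≤ arcMajorant M j := by unfold arcMajorant; positivity

theorem sum_arcMajorant_le (M : ℕ) :
    ∑ j ∈ Finset.range (4 * M), arcMajorant M j ≤ 512 * M := by
  unfold arcMajorant
  rw [← Finset.mul_sum, Finset.sum_add_distrib]
  have h1 := sum_range_inv_sq_le_two (4 * M)
  have h2 : ∑ j ∈ Finset.range (4 * M), 1 / ((4 * M : ℝ) - j) ^ 2 ≤ 2 := by
    rw [← Finset.sum_range_reflect]
    refine le_trans (le_of_eq (Finset.sum_congr rfl fun j hj => ?_)) h1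
    have : j + 1 ≤ 4 * M := Finset.mem_range.mp hj
    rw [show 4 * M - 1 - j = 4 * M - (j + 1) by omega, Nat.cast_sub this]
    push_cast
    congr 2
    ring
  calc _ ≤ 128 * (M : ℝ) * (2 + 2) := by gcongr
    _ = _ := by ring

theorem abs_sub_lt_of_arcIndex_eq {M : ℕ} (hM : 1 ≤ M) {y z : ℝ} (h : arcIndex M y = arcIndex M z) :
    |Int.fract y - Int.fract z| < 1 / (4 * M) := by
  have hM' : (1 : ℝ) ≤ M := by exact_mod_cast hM
  have b : ∀ y, (arcIndex M y : ℝ) ≤ 4 * M * Int.fract y ∧ 4 * M * Int.fract y < arcIndex M y + 1 :=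
    fun y => ⟨Nat.floor_le (by have := Int.fract_nonneg y; positivity), Nat.lt_floor_add_one _⟩
  have b1 := b y
  have b2 := b z
  rw [h] at b1
  rw [lt_div_iff₀ (by positivity), ← abs_of_pos (show (0 : ℝ) < 4 * M by positivity), ← abs_mul, abs_lt]
  constructor <;> nlinarith

/-- Two multiples of `τ` in one cell would put `(m - n) τ` within `1/(4M)` of an integer, which a
minor `τ` forbids for `0 < |m - n| ≤ M`. -/
theorem arcIndex_injOn {M : ℕ} (hM : 1 ≤ M) {τ : ℝ} (hτ : (τ : UnitAddCircle) ∈ minorArc M) {m n : ℤ}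
    (hmn : |m - n| ≤ M) (h : arcIndex M (m * τ) = arcIndex M (n * τ)) : m = n := by
  by_contra hne
  rw [abs_le] at hmn
  have hk : 1 ≤ (m - n).natAbs := by omega
  have h1 := hτ _ hk (by omega)
  have h2 := abs_sub_lt_of_arcIndex_eq hM h
  have h3 : ‖(m - n).natAbs • (τ : UnitAddCircle)‖ = ‖(((m - n) * τ : ℝ) : UnitAddCircle)‖ := by
    have : (((m - n) * τ : ℝ) : UnitAddCircle) = (m - n) • (τ : UnitAddCircle) := by
      rw [← AddCircle.coe_zsmul, zsmul_eq_mul]; push_cast; rfl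
    rw [this, ← natCast_zsmul]
    rcases Int.natAbs_eq (m - n) with h | h
    · rw [← h]
    · conv_rhs => rw [h]
      rw [neg_zsmul, norm_neg]
  rw [h3, UnitAddCircle.norm_eq] at h1
  have h4 := round_le (((m : ℝ) - n) * τ) (⌊m * τ⌋ - ⌊n * τ⌋)
  have h5 : ((m : ℝ) - n) * τ - ((⌊m * τ⌋ - ⌊n * τ⌋ : ℤ) : ℝ) = Int.fract (m * τ) - Int.fract (n * τ) := by
    rw [Int.fract, Int.fract]; push_cast; ring
  rw [h5] at h4
  linarith

/-- In a window of `M / 2 + 1` consecutive shifts the frequencies `2h` differ by at most `M`, so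
each cell is hit at most once. The majorant decays quadratically in the cell index, so its sum over
all cells carries no logarithm. -/
theorem sum_range_arcMajorant_le {M : ℕ} (hM : 1 ≤ M) {τ : ℝ} (hτ : (τ : UnitAddCircle) ∈ minorArc M)
    (a : ℤ) :
    ∑ r ∈ Finset.range (M / 2 + 1), arcMajorant M (arcIndex M ((2 * (a + r) : ℤ) * τ)) ≤ 512 * M := by
  refine le_trans ?_ (sum_arcMajorant_le M)
  have hinj : Set.InjOn (fun r : ℕ => arcIndex M ((2 * (a + r) : ℤ) * τ)) (Finset.range (M / 2 + 1)) := by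
    intro r hr s hs hrs
    simp only [Finset.coe_range, Set.mem_Iio] at hr hs
    have := arcIndex_injOn hM hτ (m := 2 * (a + r)) (n := 2 * (a + s)) (by rw [abs_le]; omega) hrs
    omega
  rw [← Finset.sum_image (f := arcMajorant M) hinj]
  refine Finset.sum_le_sum_of_subset_of_nonneg ?_ fun j _ _ => arcMajorant_nonneg M j
  intro j hj
  obtain ⟨r, _, rfl⟩ := Finset.mem_image.mp hj
  exact Finset.mem_range.mpr (arcIndex_lt hM _)

theorem sum_range_mul_arcMajorant_le {M : ℕ} (hM : 1 ≤ M) {τ : ℝ}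
    (hτ : (τ : UnitAddCircle) ∈ minorArc M) (a : ℤ) (l : ℕ) :
    ∑ r ∈ Finset.range (l * (M / 2 + 1)), arcMajorant M (arcIndex M ((2 * (a + r) : ℤ) * τ)) ≤
      l * (512 * M) := by
  induction l with
  | zero => simp
  | succ l ih =>
    rw [add_mul, one_mul, Finset.sum_range_add]
    have := sum_range_arcMajorant_le hM hτ (a + (l * (M / 2 + 1) : ℕ))
    simp only [Nat.cast_add (l * (M / 2 + 1)), ← add_assoc a] at this ⊢
    push_cast at ih this ⊢
    linarith

/-- The smoothed Weyl sum. -/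
noncomputable def tentWeylSum (M : ℕ) (x t : UnitAddCircle) : ℂ :=
  ∑ n ∈ Finset.Icc (-(2 * M : ℤ)) (2 * M), (tent M n : ℂ) * (fourier n x * fourier (n ^ 2) t)

theorem fourier_mul_coe (m n : ℤ) (τ : ℝ) :
    (fourier (n * m) (τ : UnitAddCircle) : ℂ) = fourier n ((m * τ : ℝ) : UnitAddCircle) := by
  rw [fourier_coe_apply, fourier_coe_apply]
  congr 1
  push_cast
  ring

/-- Weyl differencing: `(n + h)² - n²` is linear in `n`, and `x` enters only through a unimodular
factor independent of `n`. -/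
theorem tentWeylSum_correlation (M : ℕ) (x : UnitAddCircle) (τ : ℝ) (h n : ℤ) :
    (tent M (n + h) : ℂ) * (fourier (n + h) x * fourier ((n + h) ^ 2) (τ : UnitAddCircle)) *
      (starRingEnd ℂ) ((tent M n : ℂ) * (fourier n x * fourier (n ^ 2) (τ : UnitAddCircle))) =
    (fourier h x * fourier (h ^ 2) (τ : UnitAddCircle)) *
      (((tent M n * tent M (n + h) : ℝ) : ℂ) * fourier n (((2 * h : ℤ) * τ : ℝ) : UnitAddCircle)) := by
  rw [← fourier_mul_coe, map_mul, map_mul, Complex.conj_ofReal, ← fourier_neg, ← fourier_neg]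
  have e1 : (fourier (n + h) x : ℂ) * fourier (-n) x = fourier h x := by
    rw [← fourier_add]; congr 2; ring
  have e2 : (fourier ((n + h) ^ 2) (τ : UnitAddCircle) : ℂ) * fourier (-n ^ 2) (τ : UnitAddCircle) =
      fourier (h ^ 2) (τ : UnitAddCircle) * fourier (n * (2 * h)) (τ : UnitAddCircle) := by
    rw [← fourier_add, ← fourier_add]; congr 2; ring
  push_cast
  linear_combination (tent M (n + h) : ℂ) * tent M n * fourier ((n + h) ^ 2) (τ : UnitAddCircle) *
      fourier (-n ^ 2) (τ : UnitAddCircle) * e1 + (tent M (n + h) : ℂ) * tent M n * fourier h x * e2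

theorem norm_tentWeylSum_sq_le {M : ℕ} (hM : 1 ≤ M) {t : UnitAddCircle} (ht : t ∈ minorArc M)
    (x : UnitAddCircle) : ‖tentWeylSum M x t‖ ^ 2 ≤ 8704 * M := by
  obtain ⟨τ, rfl⟩ : ∃ τ : ℝ, (τ : UnitAddCircle) = t := QuotientAddGroup.mk_surjective t
  set T : ℤ → ℂ := fun n => (tent M n : ℂ) * (fourier n x * fourier (n ^ 2) (τ : UnitAddCircle)) with hT
  set I := Finset.Icc (-(2 * M : ℤ)) (2 * M) with hI
  have hT0 : ∀ n ∉ I, T n = 0 := by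
    intro n hn
    have : tent M n = 0 := tent_eq_zero <| by
      rw [hI, Finset.mem_Icc, ← abs_le] at hn; omega
    simp [hT, this]
  -- Differences of points of `I` lie in `[-4M, 4M]`, and `17` windows of length `M / 2 + 1` cover
  -- these `8M + 1` shifts. The surplus terms vanish because the tent does. Finally `17 · 512 =
  -- 8704`.
  have hsum : ∀ n ∈ I, ∑ m ∈ I, T m =
      ∑ r ∈ Finset.range (17 * (M / 2 + 1)), T (n + (-(4 * M) + r)) := by
    intro n hn
    rw [← Finset.sum_image (f := T) (g := fun r : ℕ => n + (-(4 * M) + (r : ℤ)))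
      (fun r _ s _ h => by simpa using h)]
    refine Finset.sum_subset ?_ fun m _ hm => hT0 m hm
    intro m hm
    rw [hI, Finset.mem_Icc] at hm hn
    refine Finset.mem_image.mpr ⟨(m - n + 4 * M).toNat, Finset.mem_range.mpr (by omega), by omega⟩
  have hsq : ((‖tentWeylSum M x τ‖ ^ 2 : ℝ) : ℂ) =
      ∑ r ∈ Finset.range (17 * (M / 2 + 1)),
        (fourier (-(4 * M) + r) x * fourier ((-(4 * M) + r) ^ 2) (τ : UnitAddCircle)) *
        ∑ n ∈ I, ((tent M n * tent M (n + (-(4 * M) + r)) : ℝ) : ℂ) *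
          fourier n (((2 * (-(4 * M) + r) : ℤ) * τ : ℝ) : UnitAddCircle) := by
    push_cast
    rw [← Complex.mul_conj']
    change (∑ n ∈ I, T n) * (starRingEnd ℂ) (∑ n ∈ I, T n) = _
    rw [map_sum, Finset.mul_sum]
    rw [Finset.sum_congr rfl fun n hn => by rw [hsum n hn, Finset.sum_mul]]
    rw [Finset.sum_comm]
    refine Finset.sum_congr rfl fun r _ => ?_
    rw [Finset.mul_sum]
    refine Finset.sum_congr rfl fun n _ => ?_
    have := tentWeylSum_correlation M x τ (-(4 * M) + r) n
    push_cast at this ⊢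
    exact this
  calc ‖tentWeylSum M x τ‖ ^ 2 = ‖((‖tentWeylSum M x τ‖ ^ 2 : ℝ) : ℂ)‖ := by
        rw [Complex.norm_real, Real.norm_eq_abs, abs_of_nonneg (by positivity)]
    _ ≤ ∑ r ∈ Finset.range (17 * (M / 2 + 1)),
        arcMajorant M (arcIndex M ((2 * (-(4 * M) + r) : ℤ) * τ)) := by
        rw [hsq]
        refine (norm_sum_le _ _).trans (Finset.sum_le_sum fun r _ => ?_)
        rw [norm_mul, norm_mul, norm_fourier_apply, norm_fourier_apply, one_mul, one_mul]
        exact tent_correlation_le hM _ _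
    _ ≤ (17 : ℕ) * (512 * M) := sum_range_mul_arcMajorant_le hM ht _ 17
    _ = 8704 * M := by push_cast; ring

/-! ### Möbius decomposition of the minor-arc indicator -/

theorem sum_divisors_moebius (n : ℕ) :
    ∑ d ∈ n.divisors, ArithmeticFunction.moebius d = if n = 1 then 1 else 0 := by
  rw [← ArithmeticFunction.coe_mul_zeta_apply, ArithmeticFunction.moebius_mul_coe_zeta,
    ArithmeticFunction.one_apply]

theorem norm_nsmul_coe (n : ℕ) (τ : ℝ) : ‖n • (τ : UnitAddCircle)‖ = |n * τ - round (n * τ)| := by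
  rw [← AddCircle.coe_nsmul, nsmul_eq_mul, UnitAddCircle.norm_eq]

theorem round_eq_of_abs_sub_lt {x : ℝ} {a : ℤ} (h : |x - a| < 1 / 2) : round x = a := by
  rw [round_eq_iff]
  rw [abs_lt] at h
  constructor <;> linarith

/-- Scaling by `d` turns closeness of `eτ` to `b` into closeness of `deτ` to `db`. Since `1/(4M) <
1/2`, the integer `db` is then the rounding of `deτ`. -/
theorem norm_nsmul_le_iff_dvd_round {M : ℕ} (hM : 1 ≤ M) {d e : ℕ} (hd : 1 ≤ d) (τ : ℝ) :
    ‖e • (τ : UnitAddCircle)‖ ≤ 1 / (4 * d * M) ↔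
      ‖(d * e) • (τ : UnitAddCircle)‖ ≤ 1 / (4 * M) ∧ (d : ℤ) ∣ round (((d * e : ℕ) : ℝ) * τ) := by
  have hM' : (1 : ℝ) ≤ M := by exact_mod_cast hM
  have hd' : (1 : ℝ) ≤ d := by exact_mod_cast hd
  have hlt : 1 / (4 * (M : ℝ)) < 1 / 2 := by
    rw [div_lt_div_iff₀ (by positivity) (by positivity)]; linarith
  have hmul : ∀ b : ℤ, |((d * e : ℕ) : ℝ) * τ - ((d * b : ℤ) : ℝ)| = d * |e * τ - b| := by
    intro b
    rw [show ((d * e : ℕ) : ℝ) * τ - ((d * b : ℤ) : ℝ) = d * (e * τ - b) by push_cast; ring, abs_mul,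
      Nat.abs_cast]
  have hiff : ∀ b : ℤ, |e * τ - b| ≤ 1 / (4 * d * M) ↔ d * |e * τ - b| ≤ 1 / (4 * M) := by
    intro b
    rw [le_div_iff₀ (by positivity), le_div_iff₀ (by positivity)]
    constructor <;> intro h <;> linarith
  rw [norm_nsmul_coe, norm_nsmul_coe]
  constructor
  · intro h
    rw [hiff, ← hmul] at h
    have hr := round_eq_of_abs_sub_lt (h.trans_lt hlt)
    rw [hr]
    exact ⟨h, dvd_mul_right _ _⟩
  · rintro ⟨h, b, hb⟩
    rw [hb, hmul, ← hiff] at h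
    exact (round_le _ b).trans h

/-- `n` is the denominator of a reduced fraction within `1 / (4nM)` of `τ`. -/
def IsApproxDenom (M : ℕ) (τ : ℝ) (n : ℕ) : Prop :=
  ‖n • (τ : UnitAddCircle)‖ ≤ 1 / (4 * M) ∧ Int.gcd n (round (n * τ)) = 1

open Classical in
-- The Möbius sum over common divisors of `n` and the numerator detects coprimality. Each of its
-- terms depends on `τ` only through `eτ`, so its Fourier coefficients are accessible.
theorem sum_moebius_indicator_eq {M : ℕ} (hM : 1 ≤ M) {n : ℕ} (hn : 1 ≤ n) (τ : ℝ) :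
    ∑ p ∈ n.divisorsAntidiagonal, ((ArithmeticFunction.moebius p.1 : ℤ) : ℝ) *
        (if ‖p.2 • (τ : UnitAddCircle)‖ ≤ 1 / (4 * p.1 * M) then 1 else 0) =
      if IsApproxDenom M τ n then 1 else 0 := by
  have h1 : ∀ p ∈ n.divisorsAntidiagonal, ((ArithmeticFunction.moebius p.1 : ℤ) : ℝ) *
        (if ‖p.2 • (τ : UnitAddCircle)‖ ≤ 1 / (4 * p.1 * M) then 1 else 0) =
      if ‖n • (τ : UnitAddCircle)‖ ≤ 1 / (4 * M) then
        (if (p.1 : ℤ) ∣ round (n * τ) then ((ArithmeticFunction.moebius p.1 : ℤ) : ℝ) else 0) else 0 := by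
    intro p hp
    obtain ⟨rfl, hne⟩ := Nat.mem_divisorsAntidiagonal.mp hp
    have := norm_nsmul_le_iff_dvd_round hM (d := p.1) (e := p.2)
      (Nat.one_le_iff_ne_zero.mpr (left_ne_zero_of_mul hne)) τ
    simp only [this]
    split_ifs <;> simp_all
  rw [Finset.sum_congr rfl h1]
  unfold IsApproxDenom
  by_cases hc : ‖n • (τ : UnitAddCircle)‖ ≤ 1 / (4 * M)
  · simp only [hc, if_true, true_and]
    rw [Nat.sum_divisorsAntidiagonal (f := fun d _ => if (d : ℤ) ∣ round (n * τ) then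
      ((ArithmeticFunction.moebius d : ℤ) : ℝ) else 0), ← Finset.sum_filter]
    have hg : Int.gcd n (round (n * τ)) ≠ 0 := by
      rw [Ne, Int.gcd_eq_zero_iff]; omega
    have hf : n.divisors.filter (fun d : ℕ => (d : ℤ) ∣ round (n * τ)) = (Int.gcd n (round (n * τ))).divisors := by
      ext d
      simp only [Finset.mem_filter, Nat.mem_divisors, Int.dvd_gcd_iff]
      constructor
      · rintro ⟨⟨h, -⟩, h2⟩; exact ⟨⟨by exact_mod_cast h, h2⟩, hg⟩
      · rintro ⟨⟨h, h2⟩, -⟩; exact ⟨⟨by exact_mod_cast h, by omega⟩, h2⟩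
    rw [hf]
    have := congrArg (Int.cast : ℤ → ℝ) (sum_divisors_moebius (Int.gcd n (round (n * τ))))
    push_cast at this
    exact this
  · simp only [hc, false_and, if_false, Finset.sum_const_zero]

theorem exists_isApproxDenom {M : ℕ} (hM : 1 ≤ M) {τ : ℝ} (hτ : (τ : UnitAddCircle) ∉ minorArc M) :
    ∃ n ∈ Finset.Icc 1 M, IsApproxDenom M τ n := by
  have hM' : (1 : ℝ) ≤ M := by exact_mod_cast hM
  simp only [minorArc, Set.mem_ofPred_eq, not_forall, not_lt] at hτ
  obtain ⟨k, hk1, hkM, hk⟩ := hτ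
  have hg0 : 0 < Int.gcd k (round (k * τ)) := Int.gcd_pos_of_ne_zero_left _ (by omega)
  obtain ⟨n, hn⟩ : Int.gcd k (round (k * τ)) ∣ k := by
    exact_mod_cast Int.gcd_dvd_left (a := (k : ℤ)) (b := round (k * τ))
  obtain ⟨a, ha⟩ := Int.gcd_dvd_right (a := (k : ℤ)) (b := round (k * τ))
  set g := Int.gcd k (round (k * τ)) with hg
  have hcop : Int.gcd n a = 1 := by
    have h1 : Int.gcd (g * n : ℤ) (g * a) = g := by
      rw [← ha, show ((g : ℤ) * n) = (k : ℤ) by rw [hn]; push_cast; rfl]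
    rw [Int.gcd_mul_left, Int.natAbs_natCast] at h1
    exact Nat.eq_of_mul_eq_mul_left hg0 (by rw [h1, mul_one])
  have hn1 : 1 ≤ n := by
    rcases Nat.eq_zero_or_pos n with h | h
    · subst h; omega
    · exact h
  have hnk : n ≤ k := by rw [hn]; exact Nat.le_mul_of_pos_left n hg0
  have hna : |n * τ - a| ≤ 1 / (4 * M) := by
    refine le_trans ?_ hk
    rw [norm_nsmul_coe, ha, hn]
    push_cast
    rw [show (g : ℝ) * n * τ - g * a = g * (n * τ - a) by ring, abs_mul, Nat.abs_cast]
    have : (1 : ℝ) ≤ g := by exact_mod_cast hg0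
    nlinarith [abs_nonneg (n * τ - a)]
  have hlt : 1 / (4 * (M : ℝ)) < 1 / 2 := by
    rw [div_lt_div_iff₀ (by positivity) (by positivity)]; linarith
  have hr := round_eq_of_abs_sub_lt (hna.trans_lt hlt)
  exact ⟨n, Finset.mem_Icc.mpr ⟨hn1, hnk.trans hkM⟩, by rw [norm_nsmul_coe, hr]; exact hna, by rw [hr]; exact hcop⟩

/-- For approximating fractions `a/m` and `b/n` with denominators at most `M`, the integer `mb - na`
has absolute value at most `1/2`. The fractions therefore coincide, and both are reduced. -/
theorem IsApproxDenom.unique {M : ℕ} {τ : ℝ} {m n : ℕ} (hm : IsApproxDenom M τ m)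
    (hn : IsApproxDenom M τ n) (hmM : m ∈ Finset.Icc 1 M) (hnM : n ∈ Finset.Icc 1 M) : m = n := by
  rw [Finset.mem_Icc] at hmM hnM
  have hM' : (1 : ℝ) ≤ M := by exact_mod_cast hmM.1.trans hmM.2
  obtain ⟨h1, h2⟩ := hm
  obtain ⟨h3, h4⟩ := hn
  rw [norm_nsmul_coe] at h1 h3
  set a := round (m * τ)
  set b := round (n * τ)
  have hm' : (m : ℝ) ≤ M := by exact_mod_cast hmM.2
  have hn' : (n : ℝ) ≤ M := by exact_mod_cast hnM.2
  have key : |((m * b - n * a : ℤ) : ℝ)| < 1 := by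
    have e : ((m * b - n * a : ℤ) : ℝ) = n * (m * τ - a) - m * (n * τ - b) := by push_cast; ring
    rw [e]
    calc _ ≤ |n * (m * τ - a)| + |m * (n * τ - b)| := abs_sub _ _
      _ ≤ M * (1 / (4 * M)) + M * (1 / (4 * M)) := by
        rw [abs_mul, abs_mul, Nat.abs_cast, Nat.abs_cast]
        gcongr
      _ = 1 / 2 := by field_simp; norm_num
      _ < 1 := by norm_num
  have h0 : (m * b - n * a : ℤ) = 0 := by
    rw [← Int.abs_lt_one_iff]; exact_mod_cast key
  have h5 : (m : ℤ) ∣ n := by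
    refine Int.dvd_of_dvd_mul_left_of_gcd_one (a := (m : ℤ)) (b := n) (c := a) ⟨b, by linarith⟩ h2
  have h6 : (n : ℤ) ∣ m := by
    refine Int.dvd_of_dvd_mul_left_of_gcd_one (a := (n : ℤ)) (b := m) (c := b) ⟨a, by linarith⟩ h4
  exact Nat.dvd_antisymm (by exact_mod_cast h5) (by exact_mod_cast h6)

open Classical in
theorem minorArc_indicator_eq {M : ℕ} (hM : 1 ≤ M) (t : UnitAddCircle) :
    (if t ∈ minorArc M then (1 : ℝ) else 0) =
      1 - ∑ n ∈ Finset.Icc 1 M, ∑ p ∈ n.divisorsAntidiagonal,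
        ((ArithmeticFunction.moebius p.1 : ℤ) : ℝ) * (if ‖p.2 • t‖ ≤ 1 / (4 * p.1 * M) then 1 else 0) := by
  obtain ⟨τ, rfl⟩ : ∃ τ : ℝ, (τ : UnitAddCircle) = t := QuotientAddGroup.mk_surjective t
  rw [Finset.sum_congr rfl fun n hn => sum_moebius_indicator_eq hM (Finset.mem_Icc.mp hn).1 τ]
  split_ifs with h
  · rw [Finset.sum_eq_zero, sub_zero]
    intro n hn
    rw [if_neg]
    intro hc
    rw [Finset.mem_Icc] at hn
    exact absurd (h n hn.1 hn.2) (not_lt.mpr hc.1)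
  · obtain ⟨n, hn, hna⟩ := exists_isApproxDenom hM h
    rw [Finset.sum_eq_single_of_mem n hn, if_pos hna, sub_self]
    intro m hm hne
    exact if_neg fun hc => hne (hc.unique hna hm hn)

/-! ### Fourier coefficients of the minor-arc indicator -/

theorem measureReal_univ_unitAddCircle : volume.real (Set.univ : Set UnitAddCircle) = 1 := by
  simp [measureReal_def]

theorem measurePreserving_nsmul_unitAddCircle {e : ℕ} (he : 1 ≤ e) :
    MeasurePreserving (fun t : UnitAddCircle => e • t) := by
  rcases he.eq_or_lt with rfl | h
  · simp only [one_smul]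
    exact MeasurePreserving.id (volume : Measure UnitAddCircle)
  · exact (AddCircle.ergodic_nsmul h).toMeasurePreserving

theorem fourier_int_mul (m n : ℤ) (t : UnitAddCircle) : (fourier (m * n) t : ℂ) = fourier m (n • t) := by
  simp only [fourier_apply, mul_zsmul]

/-- Translation by `1/e` fixes `g (e • t)` and multiplies the character by a root of unity other
than `1`. -/
theorem integral_fourier_mul_comp_nsmul_of_not_dvd {e : ℕ} (he : 1 ≤ e) {m : ℤ} (hm : ¬ (e : ℤ) ∣ m)
    (g : UnitAddCircle → ℂ) : ∫ t, (fourier (-m) t : ℂ) * g (e • t) = 0 := by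
  have he' : (e : ℝ) ≠ 0 := by exact_mod_cast (by omega : e ≠ 0)
  set c : UnitAddCircle := ((1 / e : ℝ) : UnitAddCircle) with hc
  have hec : e • c = 0 := by
    rw [hc, ← AddCircle.coe_nsmul, nsmul_eq_mul, mul_one_div_cancel he']
    exact AddCircle.coe_period 1
  have h1 : (fourier (-m) c : ℂ) ≠ 1 := by
    intro h
    rw [hc, fourier_coe_apply, Complex.exp_eq_one_iff] at h
    obtain ⟨n, hn⟩ := h
    have h2 : -(m : ℂ) / e = n := by
      have h3 : (2 * Real.pi * Complex.I : ℂ) ≠ 0 := Complex.two_pi_I_ne_zero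
      apply mul_right_cancel₀ h3
      rw [← hn]; push_cast; ring
    have he'' : (e : ℂ) ≠ 0 := by exact_mod_cast (by omega : e ≠ 0)
    rw [div_eq_iff he''] at h2
    have h4 : -m = n * e := by exact_mod_cast h2
    exact hm ⟨-n, by linarith⟩
  have h2 : ∫ t, (fourier (-m) t : ℂ) * g (e • t) =
      fourier (-m) c * ∫ t, (fourier (-m) t : ℂ) * g (e • t) := by
    conv_lhs => rw [← integral_add_right_eq_self _ c]
    rw [← integral_const_mul]
    congr 1 with t
    rw [nsmul_add, hec, add_zero]
    simp only [fourier_apply, smul_add, AddCircle.toCircle_add, Circle.coe_mul]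
    ring
  by_contra h0
  exact h1 (mul_right_cancel₀ h0 (by rw [one_mul]; exact h2.symm))

theorem integral_fourier_mul_comp_nsmul {e : ℕ} (he : 1 ≤ e) (j : ℤ) {g : UnitAddCircle → ℂ}
    (hg : Measurable g) :
    ∫ t, (fourier (-(j * e)) t : ℂ) * g (e • t) = ∫ s, (fourier (-j) s : ℂ) * g s := by
  have hmp := measurePreserving_nsmul_unitAddCircle he
  have hm := (fourier (T := (1 : ℝ)) (-j)).continuous.measurable.mul hg
  have := integral_map hmp.measurable.aemeasurable (hm.aestronglyMeasurable (μ := volume.map fun t => e • t))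
  rw [hmp.map_eq] at this
  refine Eq.trans ?_ this.symm
  congr 1 with t
  rw [← neg_mul, fourier_int_mul, natCast_zsmul]
  rfl

/-- The indicator function of the arc of radius `r` about zero. -/
noncomputable def arcIndicator (r : ℝ) (t : UnitAddCircle) : ℂ := if ‖t‖ ≤ r then 1 else 0

theorem measurable_arcIndicator (r : ℝ) : Measurable (arcIndicator r) :=
  Measurable.ite (measurableSet_le measurable_norm measurable_const) measurable_const measurable_const

theorem measureReal_norm_le {r : ℝ} (hr : 0 ≤ r) : volume.real {t : UnitAddCircle | ‖t‖ ≤ r} ≤ 2 * r := by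
  have : {t : UnitAddCircle | ‖t‖ ≤ r} = Metric.closedBall 0 r := by ext; simp
  rw [this, measureReal_def, AddCircle.volume_closedBall]
  exact ENNReal.toReal_le_of_le_ofReal (by linarith) (ENNReal.ofReal_le_ofReal (min_le_right _ _))

theorem norm_integral_fourier_mul_arcIndicator_le {r : ℝ} (hr : 0 ≤ r) (j : ℤ) :
    ‖∫ s, (fourier j s : ℂ) * arcIndicator r s‖ ≤ 2 * r := by
  have hs : MeasurableSet {t : UnitAddCircle | ‖t‖ ≤ r} := measurableSet_le measurable_norm measurable_const
  refine le_trans ?_ (measureReal_norm_le hr)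
  rw [← integral_indicator_one hs]
  refine norm_integral_le_of_norm_le ((integrable_const (1 : ℝ)).indicator hs) (.of_forall fun s => ?_)
  rw [norm_mul, norm_fourier_apply, one_mul, arcIndicator, Set.indicator]
  simp only [Set.mem_ofPred_eq, Pi.one_apply]
  split_ifs <;> simp

theorem norm_integral_fourier_mul_arcIndicator_le_inv {r : ℝ} (hr : 0 ≤ r) (hr' : r < 1 / 2) {j : ℤ}
    (hj : j ≠ 0) : ‖∫ s, (fourier j s : ℂ) * arcIndicator r s‖ ≤ 1 / |(j : ℝ)| := by
  have hj' : (j : ℝ) ≠ 0 := by exact_mod_cast hj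
  have hc : (2 * Real.pi * j * Complex.I : ℂ) ≠ 0 := by
    have : (j : ℂ) ≠ 0 := by exact_mod_cast hj
    have h2 : (Real.pi : ℂ) ≠ 0 := by exact_mod_cast Real.pi_ne_zero
    simp [this, h2]
  have h1 : ∫ s, (fourier j s : ℂ) * arcIndicator r s =
      ∫ a in (-r)..r, Complex.exp ((2 * Real.pi * j * Complex.I : ℂ) * a) := by
    rw [← UnitAddCircle.intervalIntegral_preimage (-(1 / 2)),
      intervalIntegral.integral_of_le (by norm_num), intervalIntegral.integral_of_le (by linarith),
      ← integral_Icc_eq_integral_Ioc (x := -r)]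
    have h2 : Set.Icc (-r) r = Set.Ioc (-(1 / 2)) (-(1 / 2) + 1) ∩ Set.Icc (-r) r := by
      ext x; simp only [Set.mem_Icc, Set.mem_inter_iff, Set.mem_Ioc]
      constructor
      · intro h; exact ⟨⟨by linarith, by linarith⟩, h⟩
      · exact fun h => h.2
    rw [h2, ← setIntegral_indicator measurableSet_Icc]
    refine setIntegral_congr_fun measurableSet_Ioc fun x hx => ?_
    have hx' : |x| ≤ 1 / 2 := abs_le.mpr ⟨hx.1.le, by linarith [hx.2]⟩
    have hn : ‖(x : UnitAddCircle)‖ = |x| := by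
      refine (AddCircle.norm_coe_eq_abs_iff (1 : ℝ) one_ne_zero).mpr ?_
      simpa using hx'
    simp only [arcIndicator, hn, Set.indicator, Set.mem_Icc, ← abs_le, fourier_coe_apply]
    split_ifs
    · rw [mul_one]; congr 1; push_cast; ring
    · simp
  rw [h1, integral_exp_mul_complex hc, norm_div]
  have hnum : ∀ x : ℝ, ‖Complex.exp ((2 * Real.pi * j * Complex.I : ℂ) * x)‖ = 1 := by
    intro x
    rw [show (2 * Real.pi * j * Complex.I : ℂ) * x = ((2 * Real.pi * j * x : ℝ) : ℂ) * Complex.I by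
      push_cast; ring, Complex.norm_exp_ofReal_mul_I]
  have hden : ‖(2 * Real.pi * j * Complex.I : ℂ)‖ = 2 * Real.pi * |(j : ℝ)| := by
    rw [show (2 * Real.pi * j * Complex.I : ℂ) = ((2 * Real.pi * j : ℝ) : ℂ) * Complex.I by push_cast; ring,
      norm_mul, Complex.norm_I, mul_one, Complex.norm_real, Real.norm_eq_abs, abs_mul, abs_mul,
      abs_two, abs_of_pos Real.pi_pos]
  have h2 := norm_sub_le (Complex.exp ((2 * Real.pi * j * Complex.I : ℂ) * r))
    (Complex.exp ((2 * Real.pi * j * Complex.I : ℂ) * ((-r : ℝ) : ℂ)))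
  rw [hnum, hnum] at h2
  have hj0 : 0 < |(j : ℝ)| := abs_pos.mpr hj'
  rw [hden, div_le_div_iff₀ (by positivity) hj0]
  nlinarith [Real.pi_gt_three]

/-- The indicator function of the minor arcs. -/
noncomputable def minorIndicator (M : ℕ) : UnitAddCircle → ℂ := (minorArc M).indicator 1

theorem minorIndicator_eq {M : ℕ} (hM : 1 ≤ M) (t : UnitAddCircle) :
    minorIndicator M t = 1 - ∑ n ∈ Finset.Icc 1 M, ∑ p ∈ n.divisorsAntidiagonal,
      ((ArithmeticFunction.moebius p.1 : ℤ) : ℂ) * arcIndicator (1 / (4 * p.1 * M)) (p.2 • t) := by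
  classical
  have h := congrArg (Complex.ofReal) (minorArc_indicator_eq hM t)
  rw [minorIndicator, Set.indicator]
  simp only [arcIndicator]
  push_cast [apply_ite Complex.ofReal] at h
  exact h

theorem measurableSet_minorArc (M : ℕ) : MeasurableSet (minorArc M) := by
  have : minorArc M = ⋂ k ∈ Finset.Icc 1 M, {t : UnitAddCircle | 1 / (4 * M : ℝ) < ‖k • t‖} := by
    ext t; simp [minorArc]
  rw [this]
  refine Finset.measurableSet_biInter _ fun k _ => measurableSet_lt measurable_const ?_
  exact (continuous_nsmul k).norm.measurable

theorem measurable_minorIndicator (M : ℕ) : Measurable (minorIndicator M) :=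
  measurable_one.indicator (measurableSet_minorArc M)

theorem integral_minorIndicator (M : ℕ) :
    ∫ t, minorIndicator M t = ((volume.real (minorArc M) : ℝ) : ℂ) := by
  rw [minorIndicator, integral_indicator (measurableSet_minorArc M)]
  simp

/-- Union bound: each of the `M` excluded sets has measure at most `1/(2M)`. -/
theorem half_le_measureReal_minorArc {M : ℕ} (hM : 1 ≤ M) : 1 / 2 ≤ volume.real (minorArc M) := by
  have hM' : (1 : ℝ) ≤ M := by exact_mod_cast hM
  have h1 : (minorArc M)ᶜ ⊆ ⋃ k ∈ Finset.Icc 1 M, {t : UnitAddCircle | ‖k • t‖ ≤ 1 / (4 * M)} := by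
    intro t ht
    simp only [minorArc, Set.mem_compl_iff, Set.mem_ofPred_eq, not_forall, not_lt] at ht
    obtain ⟨k, h1, h2, h3⟩ := ht
    exact Set.mem_biUnion (Finset.mem_coe.mpr (Finset.mem_Icc.mpr ⟨h1, h2⟩)) h3
  have h2 : volume.real (minorArc M)ᶜ ≤ 1 / 2 := by
    refine (measureReal_mono h1 (measure_ne_top _ _)).trans ((measureReal_biUnion_finset_le _ _).trans ?_)
    calc _ ≤ ∑ k ∈ Finset.Icc 1 M, 2 * (1 / (4 * (M : ℝ))) := by
          refine Finset.sum_le_sum fun k hk => ?_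
          have hmp := measurePreserving_nsmul_unitAddCircle (Finset.mem_Icc.mp hk).1
          have := hmp.measureReal_preimage (s := {t : UnitAddCircle | ‖t‖ ≤ 1 / (4 * (M : ℝ))})
            (measurableSet_le measurable_norm measurable_const).nullMeasurableSet
          refine (this.trans_le (measureReal_norm_le (by positivity)))
      _ = 1 / 2 := by
          rw [Finset.sum_const, Nat.card_Icc, nsmul_eq_mul]
          simp only [Nat.add_sub_cancel]
          field_simp
          norm_num
  rw [measureReal_compl (measurableSet_minorArc M), measureReal_univ_unitAddCircle] at h2
  linarith

/-- Compare `v + 1` with `p^{vε}` prime by prime. For `p ≥ 2^{1/ε}` it is no larger, as `v + 1 ≤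
2^v`; each of the fewer than `P` smaller primes costs a factor of at most `K`. -/
theorem exists_card_divisors_le_rpow {ε : ℝ} (hε : 0 < ε) :
    ∃ C : ℝ, 0 < C ∧ ∀ n : ℕ, n ≠ 0 → (n.divisors.card : ℝ) ≤ C * (n : ℝ) ^ ε := by
  set K : ℝ := max 1 (1 / (ε * Real.log 2)) with hK
  have hK1 : 1 ≤ K := le_max_left _ _
  have hlog : 0 < Real.log 2 := Real.log_pos one_lt_two
  set P : ℕ := ⌈(2 : ℝ) ^ (1 / ε)⌉₊ with hP
  have hsmall : ∀ p v : ℕ, 2 ≤ p → (v : ℝ) + 1 ≤ K * ((p : ℝ) ^ v) ^ ε := by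
    intro p v hp
    have hp' : (2 : ℝ) ≤ p := by exact_mod_cast hp
    have h1 : 1 + v * ε * Real.log 2 ≤ ((p : ℝ) ^ v) ^ ε := by
      calc 1 + v * ε * Real.log 2 ≤ Real.exp (v * ε * Real.log 2) := by
            linarith [Real.add_one_le_exp (v * ε * Real.log 2)]
        _ = ((2 : ℝ) ^ v) ^ ε := by
            rw [← Real.rpow_natCast, ← Real.rpow_mul (by norm_num), Real.rpow_def_of_pos (by norm_num)]
            congr 1; ring
        _ ≤ _ := by gcongr
    have h2 : 1 / (ε * Real.log 2) ≤ K := le_max_right _ _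
    have h3 : 1 ≤ K * (ε * Real.log 2) := by
      rwa [div_le_iff₀ (by positivity)] at h2
    calc (v : ℝ) + 1 ≤ K * (1 + v * ε * Real.log 2) := by
          nlinarith [mul_le_mul_of_nonneg_left h3 (Nat.cast_nonneg v : (0 : ℝ) ≤ v)]
      _ ≤ _ := by gcongr
  have hlarge : ∀ p v : ℕ, P ≤ p → (v : ℝ) + 1 ≤ ((p : ℝ) ^ v) ^ ε := by
    intro p v hp
    have h1 : (2 : ℝ) ^ (1 / ε) ≤ p := (Nat.le_ceil _).trans (by exact_mod_cast hp)
    calc (v : ℝ) + 1 ≤ 2 ^ v := by exact_mod_cast Nat.lt_two_pow_self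
      _ = (((2 : ℝ) ^ (1 / ε)) ^ v) ^ ε := by
        rw [← Real.rpow_natCast, ← Real.rpow_natCast, ← Real.rpow_mul (by positivity),
          ← Real.rpow_mul (by positivity)]
        congr 1
        field_simp
      _ ≤ _ := by gcongr
  refine ⟨K ^ P, by positivity, fun n hn => ?_⟩
  have hn' : (n : ℝ) ^ ε = ∏ p ∈ n.primeFactors, (((p : ℝ) ^ n.factorization p) ^ ε) := by
    rw [Real.finsetProd_rpow _ _ (fun p _ => by positivity)]
    congr 1
    conv_lhs => rw [← Nat.prod_factorization_pow_eq_self hn]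
    rw [Finsupp.prod, Nat.support_factorization]
    push_cast
    rfl
  rw [Nat.card_divisors hn, hn']
  push_cast
  calc ∏ p ∈ n.primeFactors, ((n.factorization p : ℝ) + 1)
      ≤ ∏ p ∈ n.primeFactors, ((if p < P then K else 1) * ((p : ℝ) ^ n.factorization p) ^ ε) := by
        refine Finset.prod_le_prod (fun p _ => by positivity) fun p hp => ?_
        split_ifs with h
        · exact hsmall p _ (Nat.prime_of_mem_primeFactors hp).two_le
        · rw [one_mul]; exact hlarge p _ (not_lt.mp h)
    _ ≤ _ := by
        rw [Finset.prod_mul_distrib]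
        gcongr
        rw [← Finset.prod_filter, Finset.prod_const]
        refine pow_le_pow_right₀ hK1 ?_
        calc _ ≤ (Finset.range P).card := Finset.card_le_card fun p hp => by
              simpa using (Finset.mem_filter.mp hp).2
          _ = P := Finset.card_range P

theorem integrable_fourier_mul {g : UnitAddCircle → ℂ} (hg : Measurable g) (hb : ∀ t, ‖g t‖ ≤ 1) (m : ℤ) :
    Integrable fun t => (fourier m t : ℂ) * g t := by
  refine integrable_of_measurable_of_bound (B := 1)
    ((fourier (T := (1 : ℝ)) m).continuous.measurable.mul hg) fun t => ?_
  rw [norm_mul, norm_fourier_apply, one_mul]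
  exact hb t

theorem norm_arcIndicator_le_one (r : ℝ) (t : UnitAddCircle) : ‖arcIndicator r t‖ ≤ 1 := by
  unfold arcIndicator; split_ifs <;> simp

theorem integral_fourier_eq_zero {m : ℤ} (hm : m ≠ 0) : ∫ t : UnitAddCircle, (fourier m t : ℂ) = 0 := by
  have h1 : (fourier m (((1 / (2 * m) : ℝ)) : UnitAddCircle) : ℂ) = -1 := by
    rw [fourier_coe_apply, ← Complex.exp_pi_mul_I]
    congr 1
    have : (m : ℂ) ≠ 0 := by exact_mod_cast hm
    push_cast
    field_simp
  have h2 := integral_add_right_eq_self (μ := volume) (fun t : UnitAddCircle => (fourier m t : ℂ))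
    (((1 / (2 * m) : ℝ)) : UnitAddCircle)
  simp only [fourier_apply, smul_add, AddCircle.toCircle_add, Circle.coe_mul] at h1 h2 ⊢
  rw [integral_mul_const, h1] at h2
  linear_combination (-1 / 2 : ℂ) * h2

theorem integral_fourier_mul_minorIndicator {M : ℕ} (hM : 1 ≤ M) {m : ℤ} (hm : m ≠ 0) :
    ∫ t, (fourier (-m) t : ℂ) * minorIndicator M t =
      -∑ n ∈ Finset.Icc 1 M, ∑ p ∈ n.divisorsAntidiagonal, ((ArithmeticFunction.moebius p.1 : ℤ) : ℂ) *
        ∫ t, (fourier (-m) t : ℂ) * arcIndicator (1 / (4 * p.1 * M)) (p.2 • t) := by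
  have hint : ∀ p : ℕ × ℕ, Integrable fun t : UnitAddCircle =>
      ((ArithmeticFunction.moebius p.1 : ℤ) : ℂ) *
        ((fourier (-m) t : ℂ) * arcIndicator (1 / (4 * p.1 * M)) (p.2 • t)) := fun p =>
    (integrable_fourier_mul ((measurable_arcIndicator _).comp (continuous_nsmul p.2).measurable)
      (fun t => norm_arcIndicator_le_one _ _) _).const_mul _
  simp only [minorIndicator_eq hM, mul_sub, mul_one, Finset.mul_sum, mul_left_comm (fourier (-m) _ : ℂ)]
  rw [integral_sub, integral_fourier_eq_zero (neg_ne_zero.mpr hm), zero_sub, integral_finsetSum]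
  · simp only [integral_finsetSum _ fun p _ => hint p, integral_const_mul]
  · exact fun n _ => integrable_finsetSum _ fun p _ => hint p
  · have := integrable_fourier_mul (g := fun _ => 1) measurable_const (by simp) (-m)
    simpa only [mul_one] using this
  · exact integrable_finsetSum _ fun n _ => integrable_finsetSum _ fun p _ => hint p

/-- Only pairs `(d, e)` with `e ∣ m` contribute, and they lie in `[1, M]` times the divisors of `m`.
The bound `b` is left free, to be taken from the length of the arc for small `m` and from the decay
of its coefficients for large `m`. -/
theorem norm_integral_fourier_mul_minorIndicator_le {M : ℕ} (hM : 1 ≤ M) {m : ℤ} (hm : m ≠ 0) (b : ℕ → ℝ)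
    (hb : ∀ d, 0 ≤ b d)
    (h : ∀ d e : ℕ, ∀ j : ℤ, 1 ≤ d → 1 ≤ e → e ≤ M → m = j * e →
      ‖∫ s, (fourier (-j) s : ℂ) * arcIndicator (1 / (4 * d * M)) s‖ ≤ b d) :
    ‖∫ t, (fourier (-m) t : ℂ) * minorIndicator M t‖ ≤
      m.natAbs.divisors.card * ∑ d ∈ Finset.Icc 1 M, b d := by
  classical
  rw [integral_fourier_mul_minorIndicator hM hm, norm_neg]
  calc _ ≤ ∑ n ∈ Finset.Icc 1 M, ∑ p ∈ n.divisorsAntidiagonal, (if (p.2 : ℤ) ∣ m then b p.1 else 0) := by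
        refine (norm_sum_le _ _).trans (Finset.sum_le_sum fun n hn => ?_)
        refine (norm_sum_le _ _).trans (Finset.sum_le_sum fun p hp => ?_)
        obtain ⟨rfl, hne⟩ := Nat.mem_divisorsAntidiagonal.mp hp
        have hp1 : 1 ≤ p.1 := Nat.one_le_iff_ne_zero.mpr (left_ne_zero_of_mul hne)
        have hp2 : 1 ≤ p.2 := Nat.one_le_iff_ne_zero.mpr (right_ne_zero_of_mul hne)
        have hp2M : p.2 ≤ M := (Nat.le_mul_of_pos_left _ hp1).trans (Finset.mem_Icc.mp hn).2
        rw [norm_mul]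
        split_ifs with hd
        · obtain ⟨j, hj⟩ := hd
          rw [mul_comm] at hj
          have hmu : ‖((ArithmeticFunction.moebius p.1 : ℤ) : ℂ)‖ ≤ 1 := by
            rw [Complex.norm_intCast]
            exact_mod_cast ArithmeticFunction.abs_moebius_le_one
          have := h p.1 p.2 j hp1 hp2 hp2M hj
          rw [hj, integral_fourier_mul_comp_nsmul hp2 j (measurable_arcIndicator _)]
          exact (mul_le_mul hmu this (norm_nonneg _) zero_le_one).trans_eq (one_mul _)
        · rw [integral_fourier_mul_comp_nsmul_of_not_dvd hp2 hd]
          simp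
    _ = ∑ p ∈ (Finset.Icc 1 M).biUnion Nat.divisorsAntidiagonal, (if (p.2 : ℤ) ∣ m then b p.1 else 0) := by
        rw [Finset.sum_biUnion]
        intro x _ y _ hxy
        refine Finset.disjoint_left.mpr fun p hp hp' => hxy ?_
        rw [← (Nat.mem_divisorsAntidiagonal.mp hp).1, ← (Nat.mem_divisorsAntidiagonal.mp hp').1]
    _ ≤ ∑ p ∈ Finset.Icc 1 M ×ˢ m.natAbs.divisors, b p.1 := by
        rw [← Finset.sum_filter]
        refine Finset.sum_le_sum_of_subset_of_nonneg ?_ fun p _ _ => hb _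
        intro p hp
        obtain ⟨hp, hd⟩ := Finset.mem_filter.mp hp
        obtain ⟨n, hn, hp⟩ := Finset.mem_biUnion.mp hp
        obtain ⟨rfl, hne⟩ := Nat.mem_divisorsAntidiagonal.mp hp
        rw [Finset.mem_product, Finset.mem_Icc, Nat.mem_divisors]
        refine ⟨⟨Nat.one_le_iff_ne_zero.mpr (left_ne_zero_of_mul hne), ?_⟩, ?_, by omega⟩
        · exact (Nat.le_mul_of_pos_right _ (Nat.pos_of_ne_zero (right_ne_zero_of_mul hne))).trans
            (Finset.mem_Icc.mp hn).2
        · exact Int.natCast_dvd.mp hd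
    _ = _ := by
        rw [Finset.sum_product_right]
        simp [Finset.sum_const]

theorem norm_integral_fourier_mul_minorIndicator_le_log {M : ℕ} (hM : 1 ≤ M) {m : ℤ} (hm : m ≠ 0) :
    ‖∫ t, (fourier (-m) t : ℂ) * minorIndicator M t‖ ≤
      m.natAbs.divisors.card * ((1 + Real.log M) / M) := by
  have hM' : (1 : ℝ) ≤ M := by exact_mod_cast hM
  refine (norm_integral_fourier_mul_minorIndicator_le hM hm (fun d => (d : ℝ)⁻¹ / M)
    (fun d => by positivity) ?_).trans ?_
  · intro d e j hd he heM hj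
    have hd' : (1 : ℝ) ≤ d := by exact_mod_cast hd
    refine (norm_integral_fourier_mul_arcIndicator_le (by positivity) _).trans ?_
    rw [← one_div, div_div, mul_one_div, div_le_div_iff₀ (by positivity) (by positivity)]
    have : 0 ≤ (d : ℝ) * M := by positivity
    linarith
  · gcongr
    rw [← Finset.sum_div]
    gcongr
    have := harmonic_le_one_add_log M
    rw [harmonic_eq_sum_Icc] at this
    push_cast at this
    exact this

theorem norm_integral_fourier_mul_minorIndicator_le_div {M : ℕ} (hM : 1 ≤ M) {m : ℤ} (hm : m ≠ 0) :
    ‖∫ t, (fourier (-m) t : ℂ) * minorIndicator M t‖ ≤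
      m.natAbs.divisors.card * ((M : ℝ) ^ 2 / m.natAbs) := by
  have hM' : (1 : ℝ) ≤ M := by exact_mod_cast hM
  refine (norm_integral_fourier_mul_minorIndicator_le hM hm (fun d => (M : ℝ) / m.natAbs)
    (fun d => by positivity) ?_).trans_eq ?_
  · intro d e j hd he heM hj
    have hd' : (1 : ℝ) ≤ d := by exact_mod_cast hd
    have he' : (1 : ℝ) ≤ e := by exact_mod_cast he
    have hj0 : j ≠ 0 := by rintro rfl; simp at hj; exact hm hj
    refine (norm_integral_fourier_mul_arcIndicator_le_inv (by positivity) ?_ (neg_ne_zero.mpr hj0)).trans ?_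
    · rw [div_lt_div_iff₀ (by positivity) (by positivity)]
      nlinarith
    · have hjp : 0 < |(j : ℝ)| := abs_pos.mpr (by exact_mod_cast hj0)
      have : (m.natAbs : ℝ) = |(j : ℝ)| * e := by
        rw [hj, Int.natAbs_mul, Int.natAbs_natCast]; push_cast; rw [Nat.cast_natAbs, Int.cast_abs]
      rw [this, Int.cast_neg, abs_neg, div_le_div_iff₀ hjp (by positivity), one_mul, mul_comm (M : ℝ)]
      gcongr
  · rw [Finset.sum_const, Nat.card_Icc, nsmul_eq_mul]
    simp only [Nat.add_sub_cancel]
    ring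

theorem exists_norm_integral_fourier_mul_minorIndicator_le {ε : ℝ} (hε : 0 < ε) :
    ∃ C : ℝ, 0 < C ∧ ∀ M : ℕ, 1 ≤ M → ∀ m : ℤ, m ≠ 0 →
      ‖∫ t, (fourier (-m) t : ℂ) * minorIndicator M t‖ ≤ C * (M : ℝ) ^ ε / M := by
  -- The loss is `3δ` from the divisor bound for `|m| ≤ M³` and `δ` from the logarithm.
  set δ : ℝ := min (ε / 4) 1 with hδ
  have hδ0 : 0 < δ := by positivity
  have hδ1 : δ ≤ 1 := min_le_right _ _
  have hδε : 4 * δ ≤ ε := by linarith [min_le_left (ε / 4) (1 : ℝ)]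
  obtain ⟨C, hC, hdiv⟩ := exists_card_divisors_le_rpow hδ0
  refine ⟨C * (1 + 1 / δ), by positivity, fun M hM m hm => ?_⟩
  have hM' : (1 : ℝ) ≤ M := by exact_mod_cast hM
  have hm0 : m.natAbs ≠ 0 := by omega
  have hmp : (0 : ℝ) < m.natAbs := by positivity
  have hpow : (M : ℝ) ^ (4 * δ) ≤ (M : ℝ) ^ ε := Real.rpow_le_rpow_of_exponent_le hM' hδε
  have hM3 : ∀ s : ℝ, ((M : ℝ) ^ 3) ^ s = (M : ℝ) ^ (3 * s) := by
    intro s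
    rw [← Real.rpow_natCast, ← Real.rpow_mul (by positivity)]; norm_num
  -- Beyond `M³` the decay bound gives `M² |m|^{δ-1} ≤ M^{3δ-1}`.
  rcases le_total (m.natAbs : ℝ) ((M : ℝ) ^ 3) with hc | hc
  · refine (norm_integral_fourier_mul_minorIndicator_le_log hM hm).trans ?_
    have h1 : 1 + Real.log M ≤ (1 + 1 / δ) * (M : ℝ) ^ δ := by
      have h2 := Real.log_le_rpow_div (by positivity : (0 : ℝ) ≤ M) hδ0
      have h3 : 1 ≤ (M : ℝ) ^ δ := Real.one_le_rpow hM' hδ0.le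
      calc _ ≤ (M : ℝ) ^ δ + (M : ℝ) ^ δ / δ := add_le_add h3 h2
        _ = _ := by ring
    calc _ ≤ (C * ((M : ℝ) ^ 3) ^ δ) * (((1 + 1 / δ) * (M : ℝ) ^ δ) / M) := by
          gcongr
          exact (hdiv _ hm0).trans (by gcongr)
      _ = C * (1 + 1 / δ) * (M : ℝ) ^ (4 * δ) / M := by
          rw [hM3, show 4 * δ = 3 * δ + δ by ring, Real.rpow_add (by positivity)]
          ring
      _ ≤ _ := by gcongr
  · refine (norm_integral_fourier_mul_minorIndicator_le_div hM hm).trans ?_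
    have hanti : (m.natAbs : ℝ) ^ (δ - 1) ≤ ((M : ℝ) ^ 3) ^ (δ - 1) :=
      Real.rpow_le_rpow_of_nonpos (by positivity) hc (by linarith)
    calc _ ≤ (C * (m.natAbs : ℝ) ^ δ) * ((M : ℝ) ^ 2 / m.natAbs) := by
          gcongr
          exact hdiv _ hm0
      _ = C * (m.natAbs : ℝ) ^ (δ - 1) * (M : ℝ) ^ 2 := by
          rw [Real.rpow_sub_one hmp.ne']; ring
      _ ≤ C * ((M : ℝ) ^ 3) ^ (δ - 1) * (M : ℝ) ^ 2 := by gcongr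
      _ = C * (M : ℝ) ^ (3 * δ) / M := by
          rw [hM3, show 3 * (δ - 1) = 3 * δ - (3 : ℕ) by push_cast; ring, Real.rpow_sub_natCast (by positivity)]
          field_simp
      _ ≤ C * (1 + 1 / δ) * (M : ℝ) ^ ε / M := by
          have h1 : (M : ℝ) ^ (3 * δ) ≤ (M : ℝ) ^ ε := Real.rpow_le_rpow_of_exponent_le hM' (by linarith)
          have h2 : C ≤ C * (1 + 1 / δ) := by
            have : 0 < C * (1 / δ) := by positivity
            linarith
          gcongr

/-! ### The minor-arc kernel and the restriction estimate -/

/-- The point `(|n|², n)` of the discrete paraboloid, the time frequency coming first. -/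
def paraboloidPoint {d : ℕ} (n : Fin d → ℤ) : Fin (d + 1) → ℤ := Fin.cons (∑ j, n j ^ 2) n

theorem paraboloidPoint_injective {d : ℕ} : Function.Injective (paraboloidPoint (d := d)) :=
  fun _ _ h => by simpa only [paraboloidPoint, Fin.tail_cons] using congrArg Fin.tail h

theorem mFourier_cons {d : ℕ} (m : ℤ) (n : Fin d → ℤ) (z : UnitAddTorus (Fin (d + 1))) :
    (UnitAddTorus.mFourier (Fin.cons m n : Fin (d + 1) → ℤ) z : ℂ) =
      fourier m (z 0) * ∏ j, (fourier (n j) (z j.succ) : ℂ) := by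
  simp only [UnitAddTorus.mFourier, ContinuousMap.coe_mk, Fin.prod_univ_succ, Fin.cons_zero, Fin.cons_succ]

theorem fourier_sum {ι : Type*} (s : Finset ι) (n : ι → ℤ) (t : UnitAddCircle) :
    (fourier (∑ j ∈ s, n j) t : ℂ) = ∏ j ∈ s, (fourier (n j) t : ℂ) := by
  classical
  induction s using Finset.induction_on with
  | empty => simp
  | insert i s hi ih => rw [Finset.sum_insert hi, Finset.prod_insert hi, fourier_add, ih]

/-- The smoothed kernel of the discrete paraboloid, cut off to the minor arcs. -/
noncomputable def minorKernel (d M : ℕ) (z : UnitAddTorus (Fin (d + 1))) : ℂ :=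
  minorIndicator M (z 0) * ∏ j : Fin d, tentWeylSum M (z j.succ) (z 0)

theorem measurable_minorKernel (d M : ℕ) : Measurable (minorKernel d M) := by
  have h1 : Measurable fun z : UnitAddTorus (Fin (d + 1)) => minorIndicator M (z 0) :=
    (measurable_minorIndicator M).comp (measurable_pi_apply 0)
  have h2 : Continuous fun z : UnitAddTorus (Fin (d + 1)) =>
      ∏ j : Fin d, tentWeylSum M (z j.succ) (z 0) := by
    unfold tentWeylSum
    fun_prop
  exact h1.mul h2.measurable

theorem norm_minorKernel_le {d M : ℕ} (hM : 1 ≤ M) (z : UnitAddTorus (Fin (d + 1))) :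
    ‖minorKernel d M z‖ ≤ Real.sqrt (8704 * M) ^ d := by
  rw [minorKernel, minorIndicator, Set.indicator]
  split_ifs with h
  · rw [Pi.one_apply, one_mul, norm_prod]
    refine (Finset.prod_le_prod (fun _ _ => norm_nonneg _) fun j _ =>
      Real.le_sqrt_of_sq_le (norm_tentWeylSum_sq_le hM h _)).trans_eq ?_
    simp
  · simp only [zero_mul, norm_zero]; positivity

theorem minorKernel_eq_sum (d M : ℕ) (z : UnitAddTorus (Fin (d + 1))) :
    minorKernel d M z = ∑ n ∈ Fintype.piFinset fun _ : Fin d => Finset.Icc (-(2 * M : ℤ)) (2 * M),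
      (∏ j, (tent M (n j) : ℂ)) * (UnitAddTorus.mFourier (paraboloidPoint n) z * minorIndicator M (z 0)) := by
  unfold minorKernel tentWeylSum
  rw [Finset.prod_univ_sum, Finset.mul_sum]
  refine Finset.sum_congr rfl fun n _ => ?_
  rw [paraboloidPoint, mFourier_cons, fourier_sum, Finset.prod_mul_distrib, Finset.prod_mul_distrib]
  ring

theorem integral_mFourier_mul {d : ℕ} (κ : Fin (d + 1) → ℤ) (g : UnitAddCircle → ℂ) :
    ∫ z : UnitAddTorus (Fin (d + 1)), UnitAddTorus.mFourier κ z * g (z 0) =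
      if Fin.tail κ = 0 then ∫ t, (fourier (κ 0) t : ℂ) * g t else 0 := by
  have h1 : ∀ z : UnitAddTorus (Fin (d + 1)), UnitAddTorus.mFourier κ z * g (z 0) =
      ∏ i, (Fin.cons (fun t => (fourier (κ 0) t : ℂ) * g t) (fun j t => (fourier (κ j.succ) t : ℂ)) :
        Fin (d + 1) → UnitAddCircle → ℂ) i (z i) := by
    intro z
    rw [Fin.prod_univ_succ]
    simp only [Fin.cons_zero, Fin.cons_succ]
    rw [← Fin.cons_self_tail κ, mFourier_cons, Fin.cons_zero]
    simp only [Fin.cons_succ]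
    ring
  simp only [h1]
  rw [integral_fintype_prod_volume_eq_prod, Fin.prod_univ_succ]
  simp only [Fin.cons_zero, Fin.cons_succ]
  split_ifs with h
  · rw [Finset.prod_eq_one, mul_one]
    intro j _
    have : κ j.succ = 0 := congrFun h j
    simp [this, measureReal_univ_unitAddCircle]
  · obtain ⟨j, hj⟩ := Function.ne_iff.mp h
    rw [Finset.prod_eq_zero (Finset.mem_univ j), mul_zero]
    exact integral_fourier_eq_zero hj

/-- Orthogonality in the space variables leaves only the term `n = Fin.tail k`; if that lies outside
the summation box, its tent weight is zero anyway. -/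
theorem torusCoeff_minorKernel (d M : ℕ) (k : Fin (d + 1) → ℤ) :
    torusCoeff (minorKernel d M) k = (∏ j : Fin d, (tent M (k j.succ) : ℂ)) *
      ∫ t, (fourier (-(k 0 - ∑ j : Fin d, k j.succ ^ 2)) t : ℂ) * minorIndicator M t := by
  have h1 : ∀ z : UnitAddTorus (Fin (d + 1)), UnitAddTorus.mFourier (-k) z * minorKernel d M z =
      ∑ n ∈ Fintype.piFinset fun _ : Fin d => Finset.Icc (-(2 * M : ℤ)) (2 * M),
      (∏ j, (tent M (n j) : ℂ)) *
        (UnitAddTorus.mFourier (paraboloidPoint n - k) z * minorIndicator M (z 0)) := by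
    intro z
    rw [minorKernel_eq_sum, Finset.mul_sum]
    refine Finset.sum_congr rfl fun n _ => ?_
    rw [sub_eq_add_neg, UnitAddTorus.mFourier_add]
    ring
  unfold torusCoeff
  simp only [h1]
  rw [integral_finsetSum]
  · simp only [integral_const_mul, integral_mFourier_mul]
    have htail : ∀ n : Fin d → ℤ, Fin.tail (paraboloidPoint n - k) = 0 ↔ n = Fin.tail k := by
      intro n
      rw [funext_iff, funext_iff]
      simp [Fin.tail, paraboloidPoint, sub_eq_zero]
    simp only [htail, mul_ite, mul_zero]
    rw [Finset.sum_ite_eq']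
    split_ifs with h
    · have e : (paraboloidPoint (Fin.tail k) - k) 0 = -(k 0 - ∑ j : Fin d, k j.succ ^ 2) := by
        simp [paraboloidPoint, Fin.tail]
      rw [e]
      rfl
    · simp only [Fintype.mem_piFinset, not_forall] at h
      obtain ⟨j, hj⟩ := h
      rw [Finset.prod_eq_zero (Finset.mem_univ j), zero_mul]
      have hj' : tent M (k j.succ) = 0 := tent_eq_zero <| by
        change ¬ k j.succ ∈ _ at hj
        rw [Finset.mem_Icc, ← abs_le] at hj; omega
      rw [hj', Complex.ofReal_zero]
  · intro n _
    refine Integrable.const_mul (integrable_of_measurable_of_bound (B := 1) ?_ fun z => ?_) _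
    · exact (UnitAddTorus.mFourier _).continuous.measurable.mul
        ((measurable_minorIndicator M).comp (measurable_pi_apply 0))
    · rw [norm_mul, norm_mFourier_apply, one_mul, minorIndicator, Set.indicator]
      split_ifs <;> simp

theorem prod_tent_le {d M : ℕ} (hM : 1 ≤ M) (n : Fin d → ℤ) : ∏ j, tent M (n j) ≤ 2 ^ d := by
  refine (Finset.prod_le_prod (fun _ _ => tent_nonneg _ _) fun j _ => tent_le_two hM _).trans_eq ?_
  simp

/-- A restriction estimate for the discrete paraboloid in terms of a bound `η` for the Fourier
coefficients of the minor arcs. -/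
theorem sum_norm_sq_torusCoeff_paraboloidPoint_le {d M N : ℕ} (hM : 1 ≤ M) (hNM : N ≤ M) {η : ℝ}
    (hη : ∀ m : ℤ, m ≠ 0 → ‖∫ t, (fourier (-m) t : ℂ) * minorIndicator M t‖ ≤ η) (hη0 : 0 ≤ η)
    {f : UnitAddTorus (Fin (d + 1)) → ℂ} (hf : Measurable f) {B : ℝ} (hB : ∀ z, ‖f z‖ ≤ B) :
    1 / 2 * ∑ n ∈ latticeBox d N, ‖torusCoeff f (paraboloidPoint n)‖ ^ 2 ≤
      Real.sqrt (8704 * M) ^ d * (∫ z, ‖f z‖) ^ 2 + 2 ^ d * η * ∫ z, ‖f z‖ ^ 2 := by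
  classical
  have hsum := hasSum_norm_sq_torusCoeff_mul hf hB (measurable_minorKernel d M) (norm_minorKernel_le hM)
  have hbd := norm_integral_mul_autocorrelation_le hf hB (norm_minorKernel_le (d := d) hM)
  have hpars := (hasSum_norm_sq_torusCoeff (memLp_of_measurable_of_bound hf hB 2)).mul_left (2 ^ d * η)
  set T : Finset (Fin (d + 1) → ℤ) := (latticeBox d N).image paraboloidPoint with hT
  have hleft := hasSum_sum_of_ne_finset_zero (f := fun k => if k ∈ T then 1 / 2 * ‖torusCoeff f k‖ ^ 2 else 0)
    (s := T) (fun k hk => if_neg hk) (L := SummationFilter.unconditional _)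
  -- The comparison is frequency by frequency. On the paraboloid the kernel coefficient is
  -- nonnegative, and at least `1/2` on `T`. Elsewhere its real part is at least `-2^d η`, which the
  -- added Parseval series compensates.
  have key := hasSum_le ?_ hleft ((Complex.hasSum_re hsum).add hpars)
  · calc _ = ∑ k ∈ T, (if k ∈ T then 1 / 2 * ‖torusCoeff f k‖ ^ 2 else 0) := by
          rw [Finset.sum_congr rfl fun k hk => if_pos hk, hT,
            Finset.sum_image (paraboloidPoint_injective.injOn), Finset.mul_sum]
      _ ≤ _ := key
      _ ≤ _ := by
          gcongr
          exact (Complex.re_le_norm _).trans hbd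
  · intro k
    have hre : ((‖torusCoeff f k‖ ^ 2 : ℂ) * torusCoeff (minorKernel d M) k).re =
        ‖torusCoeff f k‖ ^ 2 * (torusCoeff (minorKernel d M) k).re := by
      rw [← Complex.ofReal_pow, Complex.re_ofReal_mul]
    rw [hre, torusCoeff_minorKernel, ← Complex.ofReal_prod, Complex.re_ofReal_mul]
    have hP0 : 0 ≤ ∏ j : Fin d, tent M (k j.succ) := Finset.prod_nonneg fun j _ => tent_nonneg _ _
    have hP2 := prod_tent_le hM (fun j : Fin d => k j.succ)
    have hf0 : 0 ≤ ‖torusCoeff f k‖ ^ 2 := by positivity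
    by_cases hk : k 0 - ∑ j : Fin d, k j.succ ^ 2 = 0
    · have hv : (∫ t : UnitAddCircle, (fourier (-(k 0 - ∑ j : Fin d, k j.succ ^ 2)) t : ℂ) * minorIndicator M t).re =
          volume.real (minorArc M) := by
        rw [hk]
        simp only [neg_zero, fourier_zero, one_mul]
        rw [integral_minorIndicator, Complex.ofReal_re]
      rw [hv]
      have hvol := half_le_measureReal_minorArc hM
      have hlast : 0 ≤ 2 ^ d * η * ‖torusCoeff f k‖ ^ 2 := by positivity
      split_ifs with hkT
      · obtain ⟨n, hn, rfl⟩ := Finset.mem_image.mp hkT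
        have hP1 : 1 ≤ ∏ j : Fin d, tent M (paraboloidPoint n j.succ) := by
          rw [← Finset.prod_const_one (ι := Fin d) (s := Finset.univ)]
          refine Finset.prod_le_prod (fun _ _ => zero_le_one) fun j _ => one_le_tent hM ?_
          have := Finset.mem_Icc.mp (Fintype.mem_piFinset.mp hn j)
          simp only [paraboloidPoint, Fin.cons_succ]
          rw [abs_le]
          omega
        have h3 : 1 / 2 ≤ (∏ j : Fin d, tent M (paraboloidPoint n j.succ)) * volume.real (minorArc M) := by
          nlinarith
        nlinarith [mul_le_mul_of_nonneg_left h3 hf0]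
      · have : 0 ≤ volume.real (minorArc M) := measureReal_nonneg
        positivity
    · have hkT : k ∉ T := by
        intro h
        obtain ⟨n, _, rfl⟩ := Finset.mem_image.mp h
        simp [paraboloidPoint] at hk
      rw [if_neg hkT]
      set c := ∫ t : UnitAddCircle, (fourier (-(k 0 - ∑ j : Fin d, k j.succ ^ 2)) t : ℂ) * minorIndicator M t
      have hc : -η ≤ c.re := (abs_le.mp ((Complex.abs_re_le_norm c).trans (hη _ hk))).1
      have h3 : -(2 ^ d * η) ≤ (∏ j : Fin d, tent M (k j.succ)) * c.re := by nlinarith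
      nlinarith [mul_le_mul_of_nonneg_left h3 hf0]

/-! ### The exponential sum and duality -/

/-- `schrodingerSum` as a trigonometric polynomial on `𝕋^{d+1}`, time being the coordinate `0`. -/
noncomputable def paraboloidSum (d N : ℕ) (a : (Fin d → ℤ) → ℂ) (z : UnitAddTorus (Fin (d + 1))) : ℂ :=
  ∑ n ∈ latticeBox d N, a n * UnitAddTorus.mFourier (paraboloidPoint n) z

theorem schrodingerSum_eq_paraboloidSum (d N : ℕ) (a : (Fin d → ℤ) → ℂ) (z : UnitAddTorus (Fin (d + 1))) :
    schrodingerSum d N a (fun j => z j.succ, z 0) = paraboloidSum d N a z := by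
  refine Finset.sum_congr rfl fun n _ => ?_
  rw [paraboloidPoint, mFourier_cons]
  ring

theorem continuous_paraboloidSum (d N : ℕ) (a : (Fin d → ℤ) → ℂ) : Continuous (paraboloidSum d N a) := by
  unfold paraboloidSum
  fun_prop

theorem measurePreserving_torus_split (d : ℕ) :
    MeasurePreserving (fun z : UnitAddTorus (Fin (d + 1)) =>
      ((fun j => z j.succ, z 0) : SpaceTimeTorus d)) := by
  have h := (volume_preserving_piFinSuccAbove (fun _ : Fin (d + 1) => UnitAddCircle) 0)
  exact (Measure.measurePreserving_swap (μ := volume) (ν := volume)).comp h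

theorem measurableSet_levelSet (d N : ℕ) (a : (Fin d → ℤ) → ℂ) (lam : ℝ) :
    MeasurableSet (levelSet d N a lam) := by
  have : Continuous fun z : SpaceTimeTorus d => schrodingerSum d N a z := by
    unfold schrodingerSum
    fun_prop
  exact measurableSet_lt measurable_const this.norm.measurable

theorem measureReal_levelSet (d N : ℕ) (a : (Fin d → ℤ) → ℂ) (lam : ℝ) :
    volume.real (levelSet d N a lam) = volume.real {z | lam < ‖paraboloidSum d N a z‖} := by
  rw [← (measurePreserving_torus_split d).measureReal_preimage
    (measurableSet_levelSet d N a lam).nullMeasurableSet]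
  congr 1
  ext z
  change lam < ‖schrodingerSum d N a (fun j => z j.succ, z 0)‖ ↔ lam < ‖paraboloidSum d N a z‖
  rw [schrodingerSum_eq_paraboloidSum]

theorem norm_paraboloidSum_sq_le {d N : ℕ} {a : (Fin d → ℤ) → ℂ}
    (ha : ∑ n ∈ latticeBox d N, ‖a n‖ ^ 2 = 1) (z : UnitAddTorus (Fin (d + 1))) :
    ‖paraboloidSum d N a z‖ ^ 2 ≤ (2 * N + 1) ^ d := by
  have h1 : ‖paraboloidSum d N a z‖ ≤ ∑ n ∈ latticeBox d N, ‖a n‖ * 1 := by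
    refine (norm_sum_le _ _).trans_eq (Finset.sum_congr rfl fun n _ => ?_)
    rw [norm_mul, norm_mFourier_apply]
  have h2 := Finset.sum_mul_sq_le_sq_mul_sq (latticeBox d N) (fun n => ‖a n‖) (fun _ => 1)
  have hcard : ((latticeBox d N).card : ℝ) = (2 * N + 1) ^ d := by
    rw [latticeBox, Fintype.card_piFinset]
    simp only [Int.card_Icc, Finset.prod_const, Finset.card_univ, Fintype.card_fin]
    rw [show ((N : ℤ) + 1 - (-N)) = ((2 * N + 1 : ℕ) : ℤ) by push_cast; ring, Int.toNat_natCast]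
    push_cast; rfl
  rw [ha, one_mul] at h2
  simp only [one_pow, Finset.sum_const, nsmul_eq_mul, mul_one] at h2
  simp only [mul_one] at h1
  rw [← hcard]
  exact (pow_le_pow_left₀ (norm_nonneg _) h1 2).trans h2

/-- Duality: a level set estimate in terms of the Fourier coefficients of the phase of the
exponential sum restricted to the level set. -/
theorem exists_dual_function {d N : ℕ} {a : (Fin d → ℤ) → ℂ}
    (ha : ∑ n ∈ latticeBox d N, ‖a n‖ ^ 2 = 1) {lam : ℝ} (hlam : 0 < lam) :
    ∃ f : UnitAddTorus (Fin (d + 1)) → ℂ, Measurable f ∧ (∀ z, ‖f z‖ ≤ 1) ∧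
      (∫ z, ‖f z‖ = volume.real {z | lam < ‖paraboloidSum d N a z‖}) ∧
      (∫ z, ‖f z‖ ^ 2 = volume.real {z | lam < ‖paraboloidSum d N a z‖}) ∧
      lam ^ 2 * volume.real {z | lam < ‖paraboloidSum d N a z‖} ^ 2 ≤
        ∑ n ∈ latticeBox d N, ‖torusCoeff f (paraboloidPoint n)‖ ^ 2 := by
  classical
  have hF := continuous_paraboloidSum d N a
  set F := paraboloidSum d N a with hFdef
  set E : Set (UnitAddTorus (Fin (d + 1))) := {z | lam < ‖F z‖} with hE
  have hEm : MeasurableSet E := measurableSet_lt measurable_const hF.norm.measurable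
  -- The phase of `F` on `E`, where `F` cannot vanish because `lam > 0`; thus `conj f · F = |F|` on
  -- `E`.
  set f : UnitAddTorus (Fin (d + 1)) → ℂ := E.indicator fun z => F z / ‖F z‖ with hf
  have hfm : Measurable f :=
    (hF.measurable.div (Complex.measurable_ofReal.comp hF.norm.measurable)).indicator hEm
  have hfn : ∀ z, ‖f z‖ = E.indicator 1 z := by
    intro z
    simp only [hf, Set.indicator]
    split_ifs with h
    · have : ‖F z‖ ≠ 0 := (hlam.trans h).ne'
      rw [norm_div, Complex.norm_real, norm_norm, div_self this, Pi.one_apply]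
    · exact norm_zero
  have hfn1 : ∀ z, ‖f z‖ ≤ 1 := fun z => by
    rw [hfn, Set.indicator]; split_ifs <;> simp
  have hmul : ∀ z, (starRingEnd ℂ) (f z) * F z = ((E.indicator (fun z => ‖F z‖) z : ℝ) : ℂ) := by
    intro z
    simp only [hf, Set.indicator]
    split_ifs with h
    · have : (‖F z‖ : ℂ) ≠ 0 := by exact_mod_cast (hlam.trans h).ne'
      rw [map_div₀, Complex.conj_ofReal, div_mul_eq_mul_div, Complex.conj_mul', sq, mul_div_assoc,
        div_self this, mul_one]
    · simp
  have hbdF : ∃ B, ∀ z, ‖F z‖ ≤ B := by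
    refine ⟨Real.sqrt ((2 * N + 1) ^ d), fun z => Real.le_sqrt_of_sq_le (norm_paraboloidSum_sq_le ha z)⟩
  obtain ⟨B, hB⟩ := hbdF
  have hFint : Integrable F := integrable_of_measurable_of_bound hF.measurable hB
  refine ⟨f, hfm, hfn1, ?_, ?_, ?_⟩
  · simp only [hfn]; exact integral_indicator_one hEm
  · have : ∀ z, ‖f z‖ ^ 2 = E.indicator 1 z := fun z => by
      rw [hfn, Set.indicator]; split_ifs <;> simp
    simp only [this]; exact integral_indicator_one hEm
  · have h1 : lam * volume.real E ≤ ∫ z, E.indicator (fun z => ‖F z‖) z := by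
      rw [← integral_indicator_one hEm, ← integral_const_mul]
      refine integral_mono (((integrable_const (1 : ℝ)).indicator hEm).const_mul lam)
        (hFint.norm.indicator hEm) fun z => ?_
      simp only [Set.indicator]
      split_ifs with h
      · simpa using h.le
      · simp
    have h2 : ((∫ z, E.indicator (fun z => ‖F z‖) z : ℝ) : ℂ) =
        ∑ n ∈ latticeBox d N, a n * (starRingEnd ℂ) (torusCoeff f (paraboloidPoint n)) := by
      rw [← integral_complex_ofReal]
      simp only [← hmul]
      have h3 : ∀ z, (starRingEnd ℂ) (f z) * F z = ∑ n ∈ latticeBox d N,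
          a n * (starRingEnd ℂ) (UnitAddTorus.mFourier (-paraboloidPoint n) z * f z) := by
        intro z
        rw [hFdef, paraboloidSum, Finset.mul_sum]
        refine Finset.sum_congr rfl fun n _ => ?_
        rw [map_mul, UnitAddTorus.mFourier_neg, Complex.conj_conj]
        ring
      simp only [h3]
      rw [integral_finsetSum]
      · refine Finset.sum_congr rfl fun n _ => ?_
        rw [integral_const_mul, integral_conj]
        rfl
      · intro n _
        refine Integrable.const_mul (integrable_of_measurable_of_bound (B := 1) ?_ fun z => ?_) _
        · exact Complex.continuous_conj.measurable.comp
            ((UnitAddTorus.mFourier _).continuous.measurable.mul hfm)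
        · rw [RCLike.norm_conj, norm_mul, norm_mFourier_apply, one_mul]
          exact hfn1 z
    have h4 : lam * volume.real E ≤ ∑ n ∈ latticeBox d N, ‖a n‖ * ‖torusCoeff f (paraboloidPoint n)‖ := by
      refine h1.trans ((le_abs_self _).trans ?_)
      rw [← Real.norm_eq_abs, ← Complex.norm_real, h2]
      refine (norm_sum_le _ _).trans_eq (Finset.sum_congr rfl fun n _ => ?_)
      rw [norm_mul, RCLike.norm_conj]
    have h5 := Finset.sum_mul_sq_le_sq_mul_sq (latticeBox d N) (fun n => ‖a n‖)
      (fun n => ‖torusCoeff f (paraboloidPoint n)‖)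
    rw [ha, one_mul] at h5
    have h6 : 0 ≤ lam * volume.real E := mul_nonneg hlam.le measureReal_nonneg
    rw [← mul_pow]
    exact (pow_le_pow_left₀ h6 h4 2).trans h5

/-! ### The level set estimate -/

theorem sq_mul_measureReal_levelSet_sq_le {d M N : ℕ} (hM : 1 ≤ M) (hNM : N ≤ M) {η : ℝ}
    (hη : ∀ m : ℤ, m ≠ 0 → ‖∫ t, (fourier (-m) t : ℂ) * minorIndicator M t‖ ≤ η) (hη0 : 0 ≤ η)
    {a : (Fin d → ℤ) → ℂ} (ha : ∑ n ∈ latticeBox d N, ‖a n‖ ^ 2 = 1) {lam : ℝ} (hlam : 0 < lam) :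
    lam ^ 2 * volume.real (levelSet d N a lam) ^ 2 ≤
      2 * Real.sqrt (8704 * M) ^ d * volume.real (levelSet d N a lam) ^ 2 +
        2 * 2 ^ d * η * volume.real (levelSet d N a lam) := by
  rw [measureReal_levelSet]
  obtain ⟨f, hfm, hf1, hL1, hL2, hle⟩ := exists_dual_function ha hlam
  have := sum_norm_sq_torusCoeff_paraboloidPoint_le hM hNM hη hη0 hfm hf1
  rw [hL1, hL2] at this
  linarith

theorem sqrt_mul_pow_eq {c Q : ℝ} (hc : 0 ≤ c) (hQ : 0 ≤ Q) (d : ℕ) :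
    Real.sqrt (c * Q) ^ d = Real.sqrt c ^ d * Q ^ ((d : ℝ) / 2) := by
  rw [Real.sqrt_mul hc, mul_pow, Real.sqrt_eq_rpow Q, ← Real.rpow_natCast (Q ^ (1 / 2 : ℝ)),
    ← Real.rpow_mul hQ]
  congr 2
  ring

/-- Cauchy–Schwarz bounds `|F|²` by the number of frequencies, and `(2N + 1)² ≤ 9N² ≤ Q`. -/
theorem lam_sq_le_of_levelSet_nonempty {d N : ℕ} (hN : 1 ≤ N) {a : (Fin d → ℤ) → ℂ}
    (ha : ∑ n ∈ latticeBox d N, ‖a n‖ ^ 2 = 1) {lam : ℝ} (hlam : 0 < lam) {Q : ℝ}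
    (hQ : 9 * (N : ℝ) ^ 2 ≤ Q) {z : UnitAddTorus (Fin (d + 1))} (hz : lam < ‖paraboloidSum d N a z‖) :
    lam ^ 2 ≤ Q ^ ((d : ℝ) / 2) := by
  have hN' : (1 : ℝ) ≤ N := by exact_mod_cast hN
  have h1 : lam ^ 2 ≤ (2 * N + 1) ^ d :=
    (pow_le_pow_left₀ hlam.le hz.le 2).trans (norm_paraboloidSum_sq_le ha z)
  have hQ0 : 0 ≤ Q := le_trans (by positivity) hQ
  have h2 := sqrt_mul_pow_eq zero_le_one hQ0 d
  rw [Real.sqrt_one, one_pow, one_mul, one_mul] at h2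
  rw [← h2]
  refine h1.trans (pow_le_pow_left₀ (by positivity) (Real.le_sqrt_of_sq_le ?_) d)
  nlinarith

theorem theorem2 (d : ℕ) (hd : 1 ≤ d) :
    ∃ C₁ : ℝ, 0 < C₁ ∧ ∀ ε : ℝ, 0 < ε → ∃ C₂ : ℝ, 0 < C₂ ∧
      ∀ N : ℕ, 1 ≤ N →
      ∀ a : (Fin d → ℤ) → ℂ, ∑ n ∈ latticeBox d N, ‖a n‖ ^ 2 = 1 →
      ∀ Q : ℝ, (N : ℝ) ≤ Q →
      ∀ lam : ℝ, 0 < lam →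
        lam ^ 2 * (MeasureTheory.volume.real (levelSet d N a lam)) ^ 2 ≤
          C₁ * Q ^ ((d : ℝ) / 2) * (MeasureTheory.volume.real (levelSet d N a lam)) ^ 2 +
            C₂ * (N : ℝ) ^ ε / Q * MeasureTheory.volume.real (levelSet d N a lam) := by
  refine ⟨2 * Real.sqrt 17408 ^ d, by positivity, fun ε hε => ?_⟩
  obtain ⟨C, hC, hcoeff⟩ := exists_norm_integral_fourier_mul_minorIndicator_le (half_pos hε)
  refine ⟨2 * 2 ^ d * C * 18 ^ (ε / 2), by positivity, fun N hN a ha Q hQ lam hlam => ?_⟩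
  have hN' : (1 : ℝ) ≤ N := by exact_mod_cast hN
  have hQ1 : 1 ≤ Q := hN'.trans hQ
  have hQ0 : 0 < Q := by linarith
  have hvol : 0 ≤ volume.real (levelSet d N a lam) := measureReal_nonneg
  -- For large `Q` the first term on the right suffices. Otherwise `M ≤ 2Q ≤ 18N²`, so the loss
  -- `M^{ε/2}` becomes `18^{ε/2} N^ε`; likewise `8704 M ≤ 17408 Q`.
  rcases le_total (9 * (N : ℝ) ^ 2) Q with hc | hc
  · have hsecond : 0 ≤ 2 * 2 ^ d * C * 18 ^ (ε / 2) * (N : ℝ) ^ ε / Q *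
        volume.real (levelSet d N a lam) := by positivity
    rcases Set.eq_empty_or_nonempty {z | lam < ‖paraboloidSum d N a z‖} with he | ⟨z, hz⟩
    · rw [measureReal_levelSet, he]; simp
    · have h1 := lam_sq_le_of_levelSet_nonempty hN ha hlam hc hz
      have h2 : (1 : ℝ) ≤ 2 * Real.sqrt 17408 ^ d := by
        have : 1 ≤ Real.sqrt 17408 ^ d := one_le_pow₀ (Real.one_le_sqrt.mpr (by norm_num))
        linarith
      have h3 : lam ^ 2 ≤ 2 * Real.sqrt 17408 ^ d * Q ^ ((d : ℝ) / 2) :=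
        h1.trans (le_mul_of_one_le_left (by positivity) h2)
      have := mul_le_mul_of_nonneg_right h3 (sq_nonneg (volume.real (levelSet d N a lam)))
      linarith
  · set M := ⌈Q⌉₊ with hMdef
    have hQM : Q ≤ M := Nat.le_ceil Q
    have hM2 : (M : ℝ) ≤ 2 * Q := by linarith [Nat.ceil_lt_add_one hQ0.le]
    have hNM : N ≤ M := by exact_mod_cast hQ.trans hQM
    have hM : 1 ≤ M := hN.trans hNM
    refine (sq_mul_measureReal_levelSet_sq_le hM hNM (fun m hm => hcoeff M hM m hm) (by positivity)
      ha hlam).trans ?_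
    have h1 : Real.sqrt (8704 * M) ^ d ≤ Real.sqrt 17408 ^ d * Q ^ ((d : ℝ) / 2) := by
      rw [← sqrt_mul_pow_eq (by norm_num) hQ0.le]
      gcongr ?_ ^ d
      apply Real.sqrt_le_sqrt
      linarith
    have h2 : C * (M : ℝ) ^ (ε / 2) / M ≤ C * (18 ^ (ε / 2) * (N : ℝ) ^ ε) / Q := by
      have h3 : (M : ℝ) ^ (ε / 2) ≤ 18 ^ (ε / 2) * (N : ℝ) ^ ε := by
        calc (M : ℝ) ^ (ε / 2) ≤ (18 * (N : ℝ) ^ 2) ^ (ε / 2) := by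
              gcongr
              linarith
          _ = _ := by
              rw [Real.mul_rpow (by norm_num) (by positivity), ← Real.rpow_natCast, ← Real.rpow_mul (by positivity)]
              congr 2
              push_cast
              ring
      gcongr
    calc _ ≤ 2 * (Real.sqrt 17408 ^ d * Q ^ ((d : ℝ) / 2)) * volume.real (levelSet d N a lam) ^ 2 +
          2 * 2 ^ d * (C * (18 ^ (ε / 2) * (N : ℝ) ^ ε) / Q) * volume.real (levelSet d N a lam) := by
          gcongr
      _ = _ := by ring
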